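/- Let $A$ be a $C^*$-algebra, not assumed to be unital or separable. For a $C^*$-algebra $B$ and a tuple $\mathbf{b}=(b_1,\dots,b_k)\in B^k$, let $C^*(\mathbf{b})$ denote the sub-$C^*$-algebra of $B$ generated by $b_1,\dots,b_k$ (the smallest norm-closed $*$-subalgebra of $B$ containing $b_1,\dots,b_k$; it need not contain a unit of $B$). Let $B_{\mathrm{sa}}$ be the set of self-adjoint elements of $B$, and let $$\operatorname{Gen}_k(B)_{\mathrm{sa}}:=\{\mathbf{b}\in (B_{\mathrm{sa}})^k : C^*(\mathbf{b})=B\}.$$ If $B$ is unital, its generator rank $\operatorname{gr}(B)\in\{0,1,2,\dots,\infty\}$ is the smallest integer $k\ge 0$ such that $\operatorname{Gen}_{k+1}(B)_{\mathrm{sa}}$ is dense in $(B_{\mathrm{sa}})^{k+1}$ for the norm $\|\mathbf{b}\|=\max_i\|b_i\|$, and $\operatorname{gr}(B):=\infty$ if there is no such $k$. If $B$ is not unital, $\operatorname{gr}(B):=\operatorname{gr}(\widetilde B)$, where $\widetilde B$ is the minimal unitization of $B$. **Theorem.** For every $C^*$-algebra $A$ and every closed two-sided ideal $J$ of $A$,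 one has $\operatorname{gr}(J)\le\operatorname{gr}(A)$. -/

import Mathlib

/-- The ring `A` is unital: it has a two-sided multiplicative identity. -/
def HasUnit (A : Type*) [NonUnitalRing A] : Prop :=
  ∃ e : A, ∀ a : A, e * a = a ∧ a * e = a

/-- `C*(a₁, …, aₖ)`: the (not necessarily unital) C⋆-subalgebra of `A` generated by the entries of
the tuple `a`, i.e. the norm closure of the non-unital star subalgebra generated by them. -/
noncomputable def cstarGenerated {A : Type*} [NonUnitalCStarAlgebra A] {k : ℕ} (a : Fin k → A) :
    NonUnitalStarSubalgebra ℂ A :=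
  (NonUnitalStarAlgebra.adjoin ℂ (Set.range a)).topologicalClosure

/-- `Gen_k(A)_sa`: the self-adjoint `k`-tuples that generate `A` as a C⋆-algebra.  The ambient
space `Fin k → selfAdjoint A` carries the maximum metric. -/
def genSA (A : Type*) [NonUnitalCStarAlgebra A] (k : ℕ) : Set (Fin k → selfAdjoint A) :=
  {a | cstarGenerated (fun i => (a i : A)) = ⊤}

/-- The smallest `k ≥ 0` such that `Gen_{k+1}(A)_sa` is dense in `(A_sa)^{k+1}`, and `∞` if there is
no such `k`; no unit is adjoined. -/
noncomputable def generatorRankSA (A : Type*) [NonUnitalCStarAlgebra A] : ℕ∞ :=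
  sInf {n : ℕ∞ | ∃ k : ℕ, n = k ∧ Dense (genSA A (k + 1))}

open scoped Classical in
/-- The generator rank `gr(A)`: computed in `A` itself if `A` is unital, and in the minimal
unitization of `A` (with its C⋆-norm) otherwise. -/
noncomputable def generatorRank (A : Type*) [NonUnitalCStarAlgebra A] : ℕ∞ :=
  if HasUnit A then generatorRankSA A else generatorRankSA (Unitization ℂ A)

/-- Every C⋆-algebra contains contractions that are approximate right units for a given element. -/
theorem exists_norm_sub_mul_lt {A : Type*} [NonUnitalCStarAlgebra A] (x : A) {ε : ℝ}
    (hε : 0 < ε) : ∃ e : A, ‖e‖ ≤ 1 ∧ ‖x - x * e‖ < ε := by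
  let _ := CStarAlgebra.spectralOrder A
  let _ := CStarAlgebra.spectralOrderedRing A
  have h := CStarAlgebra.increasingApproximateUnit A
  have h1 := Metric.tendsto_nhds.1 (h.tendsto_mul_left x) ε hε
  have := h.neBot
  obtain ⟨e, he, he'⟩ := (h.eventually_norm.and h1).exists
  refine ⟨e, he, ?_⟩
  rwa [dist_comm, dist_eq_norm] at he'

/-- A closed two-sided ideal (in the sense of rings) of a C⋆-algebra absorbs complex scalars. -/
theorem TwoSidedIdeal.smul_mem_of_isClosed {A : Type*} [NonUnitalCStarAlgebra A]
    (J : TwoSidedIdeal A) (hJ : IsClosed (J : Set A)) (c : ℂ) {x : A} (hx : x ∈ J) :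
    c • x ∈ J := by
  change c • x ∈ (J : Set A)
  rw [← hJ.closure_eq, Metric.mem_closure_iff]
  intro ε hε
  have hc : 0 < ‖c‖ + 1 := by positivity
  obtain ⟨e, -, he⟩ := exists_norm_sub_mul_lt x (div_pos hε hc)
  refine ⟨x * (c • e), J.mul_mem_right _ _ hx, ?_⟩
  rw [dist_eq_norm, mul_smul_comm, ← smul_sub, norm_smul]
  calc ‖c‖ * ‖x - x * e‖ ≤ (‖c‖ + 1) * ‖x - x * e‖ := by gcongr; linarith
    _ < ε := by rwa [lt_div_iff₀' hc] at he

/-- The self-adjoint part `J ∩ J*` of a closed two-sided ideal, a C⋆-subalgebra. -/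
def TwoSidedIdeal.starCore {A : Type*} [NonUnitalCStarAlgebra A]
    (J : TwoSidedIdeal A) (hJ : IsClosed (J : Set A)) : NonUnitalStarSubalgebra ℂ A where
  carrier := {x | x ∈ J ∧ star x ∈ J}
  zero_mem' := ⟨J.zero_mem, by simp⟩
  add_mem' hx hy := ⟨J.add_mem hx.1 hy.1, by simpa using J.add_mem hx.2 hy.2⟩
  mul_mem' {x y} hx hy :=
    ⟨J.mul_mem_left _ _ hy.1, by simpa using J.mul_mem_left (star y) _ hx.2⟩
  smul_mem' c x hx := ⟨J.smul_mem_of_isClosed hJ c hx.1, by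
    simpa using J.smul_mem_of_isClosed hJ (star c) hx.2⟩
  star_mem' hx := ⟨hx.2, by simpa using hx.1⟩

/-- A closed two-sided ideal of a C⋆-algebra is closed under the involution. -/
theorem TwoSidedIdeal.star_mem_of_isClosed {A : Type*} [NonUnitalCStarAlgebra A]
    (J : TwoSidedIdeal A) (hJ : IsClosed (J : Set A)) {x : A} (hx : x ∈ J) : star x ∈ J := by
  have hB : IsClosed (J.starCore hJ : Set A) := hJ.inter (hJ.preimage continuous_star)
  change star x ∈ (J : Set A)
  rw [← hJ.closure_eq, Metric.mem_closure_iff]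
  intro ε hε
  have hxx : x * star x ∈ J.starCore hJ :=
    ⟨J.mul_mem_right _ _ hx, by simpa using J.mul_mem_right _ _ hx⟩
  obtain ⟨e, he1, he⟩ := exists_norm_sub_mul_lt (⟨x * star x, hxx⟩ : J.starCore hJ)
    (by positivity : 0 < ε ^ 2 / 2)
  refine ⟨star x * (e : A), J.mul_mem_left _ _ e.2.1, ?_⟩
  have he1' : ‖(e : A)‖ ≤ 1 := he1
  have he' : ‖x * star x - x * star x * (e : A)‖ < ε ^ 2 / 2 := he
  set d := x * star x - x * star x * (e : A) with hd
  have key : star (star x - star x * (e : A)) * (star x - star x * (e : A)) =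
      d - star (e : A) * d := by
    simp only [hd, star_sub, star_mul, star_star, sub_mul, mul_sub, mul_assoc]
    abel
  rw [dist_eq_norm]
  refine lt_of_pow_lt_pow_left₀ 2 hε.le ?_
  rw [sq, ← CStarRing.norm_star_mul_self, key]
  calc ‖d - star (e : A) * d‖ ≤ ‖d‖ + ‖star (e : A) * d‖ := norm_sub_le _ _
    _ ≤ ‖d‖ + 1 * ‖d‖ := by
      gcongr
      refine (norm_mul_le _ _).trans ?_
      rw [norm_star]
      gcongr
    _ < ε ^ 2 := by linarith

/-- A closed two-sided ideal of a C⋆-algebra `A`, regarded as a C⋆-subalgebra of `A`.  Its elements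
are exactly those of `J`; closure under scalars and the involution is automatic. -/
def TwoSidedIdeal.toCStarSubalgebra {A : Type*} [NonUnitalCStarAlgebra A]
    (J : TwoSidedIdeal A) (hJ : IsClosed (J : Set A)) : NonUnitalStarSubalgebra ℂ A where
  carrier := J
  zero_mem' := J.zero_mem
  add_mem' hx hy := J.add_mem hx hy
  mul_mem' _ hy := J.mul_mem_left _ _ hy
  smul_mem' c _ hx := J.smul_mem_of_isClosed hJ c hx
  star_mem' hx := J.star_mem_of_isClosed hJ hx

instance TwoSidedIdeal.isClosed_toCStarSubalgebra {A : Type*} [NonUnitalCStarAlgebra A]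
    (J : TwoSidedIdeal A) (hJ : IsClosed (J : Set A)) :
    IsClosed (J.toCStarSubalgebra hJ : Set A) := hJ

open Filter Topology

/-! Let B be A if A is unital and its unitization otherwise; J embeds in B as a closed ideal I. If J
has a unit, its image p is a central projection of B, and b ↦ bp is contractive and turns generating
tuples of B into generating tuples of J (`dense_genSA_of_hasUnit`).

Otherwise the unitization of J is ℂ + I inside B. It is separable, because B is finitely generated,
so by Baire category (`dense_genSA_of_forall_dense`) one element may be approximated at a time: near
every tuple μ + x there should be one whose C⋆-algebra comes within δ of a prescribed α + c
(`exists_near_cstarGenerated`).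

Nearby generating tuples b = p + y of B exist, but they leave ℂ + I. They are replaced by p + u y u,
with u running through a quasicentral approximate unit of I (`exists_quasicentral`). A spectral
cut-off v(z) of the perturbed sum of squares z, with v vanishing around the scalar part of z, is
asymptotically supported under u (`tendsto_cfc_mul_one_sub`), and there the cut-down tuple behaves
like b. This gives three perturbations. For μ ≠ 0, invertibility of Σ bⱼ² is inherited by the
cut-down tuple, so its C⋆-algebra contains 1 (`exists_isUnit_sum_sq_near`). The ideal parts can be
moved so that c is almost a right multiple of Σ xⱼ² (`exists_sum_sq_mul_near`). Then a polynomial in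
b that approximates c can be transplanted to the cut-down tuple (`exists_near_adjoin_one`). -/

/-- A closed two-sided ideal of a C⋆-algebra, presented as a star subalgebra. -/
structure IsClosedIdeal {B : Type*} [NonUnitalCStarAlgebra B]
    (I : NonUnitalStarSubalgebra ℂ B) : Prop where
  isClosed : IsClosed (I : Set B)
  mul_mem_left : ∀ (b : B) {x : B}, x ∈ I → b * x ∈ I
  mul_mem_right : ∀ (b : B) {x : B}, x ∈ I → x * b ∈ I

/-- A net of self-adjoint contractions in `I` acting as an approximate unit on `I`. -/
structure IsContractiveApproxUnit {B : Type*} [NonUnitalCStarAlgebra B]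
    (I : NonUnitalStarSubalgebra ℂ B) {ι : Type*} (l : Filter ι) (u : ι → B) : Prop where
  mem : ∀ i, u i ∈ I
  isSelfAdjoint : ∀ i, IsSelfAdjoint (u i)
  norm_le : ∀ i, ‖u i‖ ≤ 1
  tendsto_mul : ∀ k ∈ I, Tendsto (fun i => u i * k) l (𝓝 k)

/-! ### Quasicentral approximate units of closed ideals. -/

section Quasicentral

variable {B : Type*} [NonUnitalCStarAlgebra B] {I : NonUnitalStarSubalgebra ℂ B}

theorem IsContractiveApproxUnit.tendsto_mul_right {ι : Type*} {l : Filter ι} {u : ι → B}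
    (h : IsContractiveApproxUnit I l u) {k : B} (hk : k ∈ I) :
    Tendsto (fun i => k * u i) l (𝓝 k) := by
  have h1 := (continuous_star.tendsto _).comp (h.tendsto_mul (star k) (star_mem hk))
  simpa [Function.comp_def, fun i => (h.isSelfAdjoint i).star_eq] using h1

theorem exists_isContractiveApproxUnit (hI : IsClosed (I : Set B)) :
    ∃ (l : Filter {e : B // e ∈ I ∧ IsSelfAdjoint e ∧ ‖e‖ ≤ 1}),
      l.NeBot ∧ IsContractiveApproxUnit I l Subtype.val := by
  have : IsClosed (I : Set B) := hI
  let _ := CStarAlgebra.spectralOrder I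
  let _ := CStarAlgebra.spectralOrderedRing I
  have h := CStarAlgebra.increasingApproximateUnit I
  have := h.neBot
  let l0 := (CStarAlgebra.approximateUnit I).map (Subtype.val : I → B)
  have h0 : ∀ᶠ e in l0, e ∈ I ∧ IsSelfAdjoint e ∧ ‖e‖ ≤ 1 := by
    rw [eventually_map]
    filter_upwards [h.eventually_norm, h.eventually_isSelfAdjoint] with e he he'
    exact ⟨e.2, congrArg Subtype.val he', he⟩
  refine ⟨l0.comap Subtype.val, ?_, fun i => i.2.1, fun i => i.2.2.1, fun i => i.2.2.2, ?_⟩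
  · refine comap_neBot fun t ht => ?_
    obtain ⟨e, he, he'⟩ := ((h0.and ht).exists)
    exact ⟨⟨e, he⟩, he'⟩
  · intro k hk
    have h1 : Tendsto (fun e : B => e * k) l0 (𝓝 k) := by
      rw [tendsto_map'_iff]
      exact (continuous_subtype_val.tendsto _).comp (h.tendsto_mul_right (⟨k, hk⟩ : I))
    exact h1.comp tendsto_comap

/-- Bounded functionals on an ideal are uniformly concentrated on the left support. -/
theorem IsContractiveApproxUnit.eventually_functional_le {ι : Type*} {l : Filter ι} {u : ι → B}
    (h : IsContractiveApproxUnit I l u)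
    (φ : B →L[ℝ] ℝ) {ε : ℝ} (hε : 0 < ε) :
    ∀ᶠ i in l, ∀ k ∈ I, ‖k‖ ≤ 1 → φ (k - u i * k) ≤ ε := by
  let S : Set ℝ := φ '' {x | x ∈ I ∧ ‖x‖ ≤ 1}
  have hS : BddAbove S := by
    refine ⟨‖φ‖, ?_⟩
    rintro _ ⟨x, ⟨-, hx⟩, rfl⟩
    exact (Real.le_norm_self _).trans ((φ.le_opNorm x).trans (by nlinarith [norm_nonneg φ]))
  have hS0 : S.Nonempty := ⟨φ 0, 0, ⟨I.zero_mem, by simp⟩, rfl⟩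
  set N := sSup S with hN
  have hN0 : 0 ≤ N := le_csSup hS ⟨0, ⟨I.zero_mem, by simp⟩, by simp⟩
  have hle : ∀ x ∈ I, φ x ≤ N * ‖x‖ := by
    intro x hx
    rcases eq_or_ne x 0 with rfl | hx0
    · simp
    have hpos : 0 < ‖x‖ := norm_pos_iff.2 hx0
    have h1 : φ ((‖x‖⁻¹ : ℝ) • x) ≤ N := by
      refine le_csSup hS ⟨_, ⟨?_, ?_⟩, rfl⟩
      · have : ((‖x‖⁻¹ : ℝ) • x) = ((‖x‖⁻¹ : ℝ) : ℂ) • x := (Complex.coe_smul _ _).symm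
        rw [this]; exact I.smul_mem _ hx
      · rw [norm_smul, norm_inv, norm_norm, inv_mul_cancel₀ hpos.ne']
    rw [map_smul, smul_eq_mul, inv_mul_le_iff₀ hpos] at h1
    linarith
  -- Three errors of size t * ε / 3 will add up: the second-order term 2Nt², the defect of `x` from
  -- attaining the supremum `N`, and the term N t η.
  obtain ⟨t, ht0, ht⟩ : ∃ t : ℝ, 0 < t ∧ 2 * N * t ≤ ε / 3 := by
    refine ⟨ε / (6 * (N + 1)), by positivity, ?_⟩
    rw [mul_div_assoc', div_le_div_iff₀ (by positivity) (by positivity)]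
    nlinarith
  obtain ⟨_, ⟨x, ⟨hxI, hx1⟩, rfl⟩, hx⟩ := exists_lt_of_lt_csSup hS0
    (show N - t * (ε / 3) < sSup S by rw [← hN]; nlinarith)
  have hη : 0 < ε / (3 * (N + 1)) := by positivity
  have hev := Metric.tendsto_nhds.1 (h.tendsto_mul x hxI) _ hη
  filter_upwards [hev] with i hi k hk hk1
  rw [dist_eq_norm] at hi
  set j := k - u i * k with hj
  have hjI : j ∈ I := I.sub_mem hk (I.mul_mem (h.mem i) hk)
  have hj2 : ‖j‖ ≤ 2 := by
    refine (norm_sub_le _ _).trans ?_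
    have := (norm_mul_le (u i) k)
    nlinarith [norm_nonneg k, h.norm_le i, norm_nonneg (u i)]
  set η := ε / (3 * (N + 1))
  -- As `u i * x` is close to `x`, the elements `x` and `j` have almost orthogonal ranges. Adding `t
  -- • j` then raises the norm of `x` only to second order in `t`, so `φ j` cannot be large when `x`
  -- nearly maximizes `φ`.
  have hxj : ‖star x * j‖ ≤ η := by
    have e1 : star x * j = - star (u i * x - x) * k := by
      simp only [hj, star_sub, star_mul, (h.isSelfAdjoint i).star_eq, mul_sub, neg_mul, sub_mul,
        mul_assoc]
      abel
    rw [e1, neg_mul, norm_neg]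
    refine (norm_mul_le _ _).trans ?_
    rw [norm_star]
    nlinarith [norm_nonneg (u i * x - x), norm_nonneg k]
  have hsq : ‖x + t • j‖ ^ 2 ≤ 1 + 4 * t ^ 2 + 2 * t * η := by
    rw [sq, ← CStarRing.norm_star_mul_self]
    have e2 : star (x + t • j) * (x + t • j) =
        star x * x + t • (star x * j) + t • star (star x * j) + (t * t) • (star j * j) := by
      simp only [star_add, star_smul, star_trivial, add_mul, mul_add, smul_mul_assoc,
        mul_smul_comm, star_mul, star_star, smul_add, mul_smul]
      abel
    rw [e2]
    refine (norm_add_le _ _).trans ?_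
    refine (add_le_add (norm_add_le _ _) le_rfl).trans ?_
    refine (add_le_add (add_le_add (norm_add_le _ _) le_rfl) le_rfl).trans ?_
    rw [norm_smul, norm_smul, norm_smul, norm_star, CStarRing.norm_star_mul_self,
      CStarRing.norm_star_mul_self, Real.norm_of_nonneg ht0.le,
      Real.norm_of_nonneg (by positivity)]
    have a1 : ‖x‖ * ‖x‖ ≤ 1 := by nlinarith [norm_nonneg x]
    have a2 : ‖j‖ * ‖j‖ ≤ 4 := by nlinarith [norm_nonneg j]
    have a3 : t * ‖star x * j‖ ≤ t * η := by gcongr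
    have a4 : t * t * (‖j‖ * ‖j‖) ≤ t * t * 4 := by gcongr
    nlinarith
  have hη0 : 0 ≤ η := hη.le
  have hnorm : ‖x + t • j‖ ≤ 1 + 2 * t ^ 2 + t * η := by
    refine abs_le_of_sq_le_sq' (hsq.trans ?_) (by positivity) |>.2
    nlinarith [sq_nonneg (2 * t ^ 2 + t * η)]
  have hmem : x + t • j ∈ I := by
    have : t • j = (t : ℂ) • j := (Complex.coe_smul _ _).symm
    rw [this]
    exact I.add_mem hxI (I.smul_mem _ hjI)
  have h1 := hle _ hmem
  rw [map_add, map_smul, smul_eq_mul] at h1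
  have h2 : N * ‖x + t • j‖ ≤ N * (1 + 2 * t ^ 2 + t * η) := by gcongr
  have h3 : N * η ≤ ε / 3 := by
    simp only [η]
    rw [mul_div_assoc', div_le_div_iff₀ (by positivity) (by positivity)]
    nlinarith
  have h4 : t * φ j ≤ t * ε := by nlinarith
  exact le_of_mul_le_mul_left h4 ht0

theorem IsContractiveApproxUnit.eventually_abs_functional_le {ι : Type*} {l : Filter ι}
    {u : ι → B} (h : IsContractiveApproxUnit I l u) (φ : B →L[ℝ] ℝ) {ε M : ℝ} (hε : 0 < ε)
    (hM : 0 < M) :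
    ∀ᶠ i in l, ∀ k ∈ I, ‖k‖ ≤ M → |φ (k - u i * k)| ≤ ε := by
  filter_upwards [h.eventually_functional_le φ (div_pos hε hM)] with i hi k hk hkM
  have key : ∀ k ∈ I, ‖k‖ ≤ M → φ (k - u i * k) ≤ ε := by
    intro k hk hkM
    have h1 := hi (((M⁻¹ : ℝ) : ℂ) • k) (I.smul_mem _ hk) (by
      rw [norm_smul, Complex.norm_real, Real.norm_of_nonneg (by positivity), inv_mul_le_iff₀ hM]
      linarith)
    rw [mul_smul_comm, ← smul_sub, Complex.coe_smul, map_smul, smul_eq_mul,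
      inv_mul_le_iff₀ hM] at h1
    rwa [mul_div_cancel₀ _ hM.ne'] at h1
  refine abs_le.2 ⟨?_, key k hk hkM⟩
  have h2 := key (-k) (I.neg_mem hk) (by simpa using hkM)
  rw [mul_neg, sub_neg_eq_add, neg_add_eq_sub, ← neg_sub, map_neg] at h2
  linarith

theorem IsContractiveApproxUnit.eventually_abs_functional_le_right {ι : Type*} {l : Filter ι}
    {u : ι → B} (h : IsContractiveApproxUnit I l u) (φ : B →L[ℝ] ℝ) {ε M : ℝ} (hε : 0 < ε)
    (hM : 0 < M) :
    ∀ᶠ i in l, ∀ k ∈ I, ‖k‖ ≤ M → |φ (k - k * u i)| ≤ ε := by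
  let st : B →L[ℝ] B := ((starL' ℝ : B ≃L[ℝ] B) : B →L[ℝ] B)
  filter_upwards [h.eventually_abs_functional_le (φ.comp st) hε hM] with i hi k hk hkM
  have h1 := hi (star k) (star_mem hk) (by simpa using hkM)
  have h2 : st (star k - u i * star k) = k - k * u i := by
    change star (star k - u i * star k) = _
    simp [(h.isSelfAdjoint i).star_eq]
  rwa [ContinuousLinearMap.comp_apply, h2] at h1

/-- Commutators with an approximate unit of an ideal converge weakly to zero. -/
theorem IsContractiveApproxUnit.tendsto_functional_commutator (hI : IsClosedIdeal I)
    {ι : Type*} {l : Filter ι} [l.NeBot]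
    {u : ι → B} (h : IsContractiveApproxUnit I l u) (φ : B →L[ℝ] ℝ) (a : B) :
    Tendsto (fun i => φ (u i * a - a * u i)) l (𝓝 0) := by
  rw [Metric.tendsto_nhds]
  intro ε hε
  have hM : 0 < ‖a‖ + 1 := by positivity
  -- The chain is φ(uᵢa) ≈ φ(uᵢauⱼ) ≈ φ(auⱼ) ≈ φ(auⱼuᵢ) ≈ φ(auᵢ). The outer steps let j grow with i
  -- fixed; the inner ones use the estimates uniform in k, at k = auⱼ. Each costs ε/5.
  filter_upwards [h.eventually_abs_functional_le φ (show 0 < ε / 5 by positivity) hM,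
    h.eventually_abs_functional_le_right φ (show 0 < ε / 5 by positivity) hM] with i h1 h2
  have c1 : Tendsto (fun j => φ (u i * a * u j)) l (𝓝 (φ (u i * a))) :=
    (φ.continuous.tendsto _).comp (h.tendsto_mul_right (hI.mul_mem_right _ (h.mem i)))
  have c2 : Tendsto (fun j => φ (a * (u j * u i))) l (𝓝 (φ (a * u i))) :=
    (φ.continuous.tendsto _).comp ((h.tendsto_mul _ (h.mem i)).const_mul a)
  obtain ⟨j, hj1, hj2⟩ := ((Metric.tendsto_nhds.1 c1 (ε / 5) (by positivity)).and
    (Metric.tendsto_nhds.1 c2 (ε / 5) (by positivity))).exists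
  rw [Real.dist_eq] at hj1 hj2
  have hk : a * u j ∈ I := hI.mul_mem_left _ (h.mem j)
  have hkn : ‖a * u j‖ ≤ ‖a‖ + 1 := by
    refine (norm_mul_le _ _).trans ?_
    nlinarith [norm_nonneg a, h.norm_le j]
  have e1 := h1 _ hk hkn
  have e2 := h2 _ hk hkn
  rw [dist_zero_right, Real.norm_eq_abs]
  simp only [map_sub, ← mul_assoc] at *
  rw [abs_lt] at hj1 hj2 ⊢
  rw [abs_le] at e1 e2
  constructor <;> linarith

/-- Commutators tend to 0 only weakly, but Hahn–Banach upgrades this to norm smallness after convex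
combinations. The remaining requirements on `u` survive convex combinations, so they are built into
the convex set `C`. -/
theorem exists_quasicentral_finset (hI : IsClosedIdeal I) (F : Finset B) {ε : ℝ} (hε : 0 < ε) :
    ∃ u ∈ I, IsSelfAdjoint u ∧ ‖u‖ ≤ 1 ∧ (∀ a ∈ F, ‖u * a - a * u‖ < ε) ∧
      ∀ k ∈ F, k ∈ I → ‖u * k - k‖ ≤ ε := by
  classical
  obtain ⟨l, hl, h⟩ := exists_isContractiveApproxUnit hI.isClosed
  let C : Set B := {u | u ∈ I ∧ IsSelfAdjoint u ∧ ‖u‖ ≤ 1 ∧ ∀ k ∈ F, k ∈ I → ‖u * k - k‖ ≤ ε}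
  have hC : Convex ℝ C := by
    rintro x ⟨hx1, hx2, hx3, hx4⟩ y ⟨hy1, hy2, hy3, hy4⟩ s t hs ht hst
    refine ⟨?_, ?_, ?_, ?_⟩
    · rw [← Complex.coe_smul, ← Complex.coe_smul]
      exact I.add_mem (I.smul_mem _ hx1) (I.smul_mem _ hy1)
    · exact (IsSelfAdjoint.smul (.all s) hx2).add (IsSelfAdjoint.smul (.all t) hy2)
    · refine (norm_add_le _ _).trans ?_
      rw [norm_smul, norm_smul, Real.norm_of_nonneg hs, Real.norm_of_nonneg ht]
      nlinarith
    · intro k hk hkI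
      have e : (s • x + t • y) * k - k = s • (x * k - k) + t • (y * k - k) := by
        have : k = (s + t) • k := by rw [hst, one_smul]
        rw [add_mul, smul_mul_assoc, smul_mul_assoc, smul_sub, smul_sub]
        nth_rw 3 [this]
        rw [add_smul]
        abel
      rw [e]
      refine (norm_add_le _ _).trans ?_
      rw [norm_smul, norm_smul, Real.norm_of_nonneg hs, Real.norm_of_nonneg ht]
      have := hx4 k hk hkI
      have := hy4 k hk hkI
      nlinarith
  let T : B →ₗ[ℝ] (F → B) :=
    LinearMap.pi fun a => LinearMap.mulRight ℝ (a : B) - LinearMap.mulLeft ℝ (a : B)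
  have hT : ∀ u a, T u a = u * a - a * u := fun u a => rfl
  have hmem : (0 : F → B) ∈ closure (T '' C) := by
    by_contra h0
    obtain ⟨f, s, hf1, hf2⟩ := geometric_hahn_banach_point_closed
      (hC.linear_image T).closure isClosed_closure h0
    rw [map_zero] at hf1
    have hlim : Tendsto (fun i => f (T (Subtype.val i))) l (𝓝 0) := by
      have hsum : ∀ w : F → B, f w = ∑ a : F, f (Pi.single a (w a)) := by
        intro w
        rw [← map_sum, Finset.univ_sum_single]
      rw [funext fun i => hsum (T (Subtype.val i)), show (0 : ℝ) = ∑ _a : F, (0 : ℝ) by simp]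
      refine tendsto_finsetSum _ fun a _ => ?_
      exact h.tendsto_functional_commutator hI
        (f.comp (ContinuousLinearMap.single ℝ (fun _ : F => B) a)) (a : B)
    have hev : ∀ᶠ i : {e : B // e ∈ I ∧ IsSelfAdjoint e ∧ ‖e‖ ≤ 1} in l, (i : B) ∈ C := by
      have : ∀ᶠ i : {e : B // e ∈ I ∧ IsSelfAdjoint e ∧ ‖e‖ ≤ 1} in l,
          ∀ k ∈ F, k ∈ I → ‖(i : B) * k - k‖ ≤ ε := by
        rw [Filter.eventually_all_finset]
        intro k _
        by_cases hkI : k ∈ I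
        · filter_upwards [Metric.tendsto_nhds.1 (h.tendsto_mul k hkI) ε hε] with i hi _
          rw [dist_eq_norm] at hi
          exact hi.le
        · exact .of_forall fun i hk => absurd hk hkI
      filter_upwards [this] with i hi
      exact ⟨i.2.1, i.2.2.1, i.2.2.2, hi⟩
    obtain ⟨i, hi1, hi2⟩ := (hev.and (hlim.eventually (gt_mem_nhds hf1))).exists
    exact (hf2 _ (subset_closure ⟨_, hi1, rfl⟩)).not_gt hi2
  obtain ⟨_, ⟨u, hu, rfl⟩, hd⟩ := Metric.mem_closure_iff.1 hmem ε hε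
  refine ⟨u, hu.1, hu.2.1, hu.2.2.1, fun a ha => ?_, hu.2.2.2⟩
  rw [dist_zero_left] at hd
  rw [← hT u ⟨a, ha⟩]
  exact (norm_le_pi_norm _ _).trans_lt hd

/-- Existence of quasicentral approximate units. -/
theorem exists_quasicentral (hI : IsClosedIdeal I) :
    ∃ u : Finset B × ℕ → B, IsContractiveApproxUnit I atTop u ∧
      ∀ a, Tendsto (fun i => u i * a - a * u i) atTop (𝓝 0) := by
  choose u h1 h2 h3 h4 h5 using fun i : Finset B × ℕ =>
    exists_quasicentral_finset hI i.1 (Nat.one_div_pos_of_nat (α := ℝ) (n := i.2))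
  have hev : ∀ (a : B) (ε : ℝ), 0 < ε → ∀ᶠ i : Finset B × ℕ in atTop,
      a ∈ i.1 ∧ 1 / ((i.2 : ℝ) + 1) < ε := by
    intro a ε hε
    obtain ⟨n, hn⟩ := exists_nat_one_div_lt hε
    filter_upwards [eventually_ge_atTop (({a}, n) : Finset B × ℕ)] with i hi
    refine ⟨by simpa using hi.1, lt_of_le_of_lt ?_ hn⟩
    have : (n : ℝ) ≤ i.2 := by exact_mod_cast hi.2
    gcongr
  refine ⟨u, ⟨h1, h2, h3, fun k hk => ?_⟩, fun a => ?_⟩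
  · rw [Metric.tendsto_nhds]
    intro ε hε
    filter_upwards [hev k ε hε] with i hi
    rw [dist_eq_norm]
    exact (h5 i k hi.1 hk).trans_lt hi.2
  · rw [Metric.tendsto_nhds]
    intro ε hε
    filter_upwards [hev a ε hε] with i hi
    rw [dist_zero_right]
    exact (h4 i a hi.1).trans hi.2

end Quasicentral

/-! ### Invertible sums of squares, and spectral cut-offs under an approximate unit. -/

theorem mem_adjoin_range_induction {B : Type*} [NonUnitalCStarAlgebra B] {n : ℕ} {b : Fin n → B}
    (hb : ∀ i, IsSelfAdjoint (b i)) {p : B → Prop} (gen : ∀ i, p (b i)) (zero : p 0)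
    (add : ∀ x y, p x → p y → p (x + y)) (mul : ∀ x y, p x → p y → p (x * y))
    (smul : ∀ (c : ℂ) x, p x → p (c • x)) {w : B}
    (hw : w ∈ NonUnitalStarAlgebra.adjoin ℂ (Set.range b)) : p w := by
  -- The star subalgebra is the algebra generated by the bᵢ and their adjoints; self-adjointness
  -- makes the latter redundant, so `p` need not be stable under `star`.
  change w ∈ NonUnitalAlgebra.adjoin ℂ (Set.range b ∪ star (Set.range b)) at hw
  induction hw using NonUnitalAlgebra.adjoin_induction with
  | mem x hx =>
    rcases hx with ⟨i, rfl⟩ | ⟨i, hi⟩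
    · exact gen i
    · rw [← star_star x, ← hi, (hb i).star_eq]
      exact gen i
  | add x y _ _ hx hy => exact add x y hx hy
  | zero => exact zero
  | mul x y _ _ hx hy => exact mul x y hx hy
  | smul c x _ hx => exact smul c x hx

section

variable {B : Type*} [CStarAlgebra B]

theorem tendsto_zero_mul_of_norm_le {ι : Type*} {l : Filter ι} {f g : ι → B} {M : ℝ}
    (hf : Tendsto f l (𝓝 0)) (hg : ∀ i, ‖g i‖ ≤ M) : Tendsto (fun i => f i * g i) l (𝓝 0) :=
  hf.zero_mul_isBoundedUnder_le (isBoundedUnder_of ⟨M, hg⟩)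

theorem tendsto_mul_zero_of_norm_le {ι : Type*} {l : Filter ι} {f g : ι → B} {M : ℝ}
    (hf : Tendsto f l (𝓝 0)) (hg : ∀ i, ‖g i‖ ≤ M) : Tendsto (fun i => g i * f i) l (𝓝 0) :=
  isBoundedUnder_le_mul_tendsto_zero (isBoundedUnder_of ⟨M, hg⟩) hf

/-- If `1` is a left combination of self-adjoint `bᵢ`, then `Σ bᵢ²` is invertible. -/
theorem isUnit_sum_sq_of_sum_mul_eq_one {n : ℕ} {b c : Fin n → B}
    (hb : ∀ i, IsSelfAdjoint (b i)) (h1 : ∑ i, c i * b i = 1) : IsUnit (∑ i, b i * b i) := by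
  let _ := CStarAlgebra.spectralOrder B
  let _ := CStarAlgebra.spectralOrderedRing B
  set s := ∑ i, b i * b i with hs
  have hbb : ∀ i, 0 ≤ b i * b i := fun i => (hb i).mul_self_nonneg
  have hs0 : 0 ≤ s := Finset.sum_nonneg fun i _ => hbb i
  by_contra hu
  have hspec : (0 : ℝ) ∈ spectrum ℝ s := spectrum.zero_mem_iff ℝ |>.2 hu
  set C := ∑ i, ‖c i‖ with hC
  have hC0 : 0 ≤ C := Finset.sum_nonneg fun i _ => norm_nonneg _
  -- If 0 were in the spectrum, `f = v(s)` would have norm at least 1, yet ‖bᵢf‖² ≤ ‖fsf‖ ≤ τ².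
  -- Writing f = Σ cᵢbᵢf gives ‖f‖ ≤ Cτ, and τ is chosen to make this less than 1.
  set τ : ℝ := 1 / (2 * (C + 1)) with hτ
  have hτ0 : 0 < τ := by positivity
  let v : ℝ → ℝ := fun t => max 0 (1 - |t| / τ ^ 2)
  have hv : Continuous v := by fun_prop
  have hvb : ∀ t, |v t| ≤ 1 := by
    intro t
    have : 0 ≤ |t| / τ ^ 2 := by positivity
    rw [abs_of_nonneg (le_max_left _ _)]
    exact max_le zero_le_one (by linarith)
  set f := cfc v s with hf
  have hfsa : IsSelfAdjoint f := cfc_predicate v s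
  have hf1 : 1 ≤ ‖f‖ := by
    have := norm_apply_le_norm_cfc v s hspec hv.continuousOn
    simpa [v] using this
  have hfsf : f * s * f = cfc (fun t => v t * t * v t) s := by
    rw [cfc_mul (fun t => v t * t) v s (by fun_prop) (by fun_prop),
      cfc_mul v (fun t => t) s (by fun_prop) (by fun_prop), cfc_id' ℝ s]
  have hn : ‖f * s * f‖ ≤ τ ^ 2 := by
    rw [hfsf]
    refine norm_cfc_le (by positivity) fun t _ => ?_
    rw [Real.norm_eq_abs, abs_mul, abs_mul]
    by_cases ht : |t| ≤ τ ^ 2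
    · calc |v t| * |t| * |v t| ≤ 1 * τ ^ 2 * 1 := by gcongr <;> exact hvb t
        _ = _ := by ring
    · have : v t = 0 := by
        refine max_eq_left ?_
        rw [sub_nonpos, one_le_div (by positivity)]
        exact (not_le.1 ht).le
      simp [this]
      positivity
  have hbf : ∀ i, ‖b i * f‖ ≤ τ := by
    intro i
    refine le_of_sq_le_sq ?_ hτ0.le
    rw [sq, ← CStarRing.norm_star_mul_self, star_mul, (hb i).star_eq, hfsa.star_eq]
    refine le_trans ?_ hn
    have e : f * b i * (b i * f) = f * (b i * b i) * f := by simp only [mul_assoc]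
    rw [e]
    refine CStarAlgebra.norm_le_norm_of_nonneg_of_le ?_ ?_
    · exact hfsa.conjugate_nonneg (hbb i)
    · refine hfsa.conjugate_le_conjugate ?_
      exact Finset.single_le_sum (f := fun i => b i * b i) (fun i _ => hbb i) (Finset.mem_univ i)
  have : ‖f‖ ≤ C * τ := by
    calc ‖f‖ = ‖∑ i, c i * (b i * f)‖ := by
          simp only [← mul_assoc, ← Finset.sum_mul, h1, one_mul]
      _ ≤ ∑ i, ‖c i‖ * τ := by
          refine (norm_sum_le _ _).trans (Finset.sum_le_sum fun i _ => ?_)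
          refine (norm_mul_le _ _).trans ?_
          gcongr
          exact hbf i
      _ = C * τ := by rw [hC, Finset.sum_mul]
  have h2 : C * τ < 1 := by
    rw [hτ, mul_one_div, div_lt_one (by positivity)]
    linarith
  linarith

/-- The algebra generated by the bᵢ lies in the left ideal they span. It has an element at distance
less than 1 from 1, hence invertible, so 1 is a left combination of the bᵢ. -/
theorem isUnit_sum_sq_of_generates {n : ℕ} {b : Fin n → B}
    (hb : ∀ i, IsSelfAdjoint (b i)) (hgen : cstarGenerated b = ⊤) :
    IsUnit (∑ i, b i * b i) := by
  have hsub : ∀ w ∈ NonUnitalStarAlgebra.adjoin ℂ (Set.range b), w ∈ Ideal.span (Set.range b) := by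
    intro w hw
    refine mem_adjoin_range_induction hb (p := fun w => w ∈ Ideal.span (Set.range b))
      (fun i => Ideal.subset_span ⟨i, rfl⟩) (zero_mem _) (fun x y => add_mem)
      (fun x y _ hy => Ideal.mul_mem_left _ _ hy) (fun c x hx => ?_) hw
    rw [← one_mul x, ← smul_mul_assoc]
    exact Ideal.mul_mem_left _ _ hx
  have h1 : (1 : B) ∈ cstarGenerated b := hgen ▸ trivial
  obtain ⟨w, hw, hd⟩ := Metric.mem_closure_iff.1 h1 1 one_pos
  rw [dist_eq_norm] at hd
  have hu : IsUnit w := by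
    have := (Units.oneSub (1 - w) hd).isUnit
    simpa using this
  have htop : Ideal.span (Set.range b) = ⊤ := Ideal.eq_top_of_isUnit_mem _ (hsub w hw) hu
  obtain ⟨c, hc⟩ := Ideal.mem_span_range_iff_exists_fun.1
    (htop ▸ Submodule.mem_top : (1 : B) ∈ Ideal.span (Set.range b))
  exact isUnit_sum_sq_of_sum_mul_eq_one hb hc

theorem exists_generates_of_dense {n : ℕ} (hB : Dense (genSA B n)) {a : Fin n → B}
    (ha : ∀ i, IsSelfAdjoint (a i)) {ε : ℝ} (hε : 0 < ε) :
    ∃ b : Fin n → B, (∀ i, IsSelfAdjoint (b i)) ∧ (∀ i, ‖b i - a i‖ < ε) ∧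
      cstarGenerated b = ⊤ := by
  obtain ⟨b, hb, hd⟩ := Metric.dense_iff.1 hB (fun i => ⟨a i, ha i⟩) ε hε
  refine ⟨fun i => b i, fun i => (b i).2, fun i => ?_, hd⟩
  have := (dist_pi_lt_iff hε).1 hb i
  rwa [Subtype.dist_eq, dist_eq_norm] at this

variable {I : NonUnitalStarSubalgebra ℂ B} {ι : Type*} {l : Filter ι} {u : ι → B}

theorem IsContractiveApproxUnit.norm_conj_le (hu : IsContractiveApproxUnit I l u) (i : ι) (y : B) :
    ‖u i * y * u i‖ ≤ ‖y‖ := by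
  refine (norm_mul_le _ _).trans ?_
  have h1 := hu.norm_le i
  have h2 := norm_mul_le (u i) y
  nlinarith [norm_nonneg (u i), norm_nonneg y, norm_nonneg (u i * y)]

/-- If `zᵢ = μ + j + rᵢ` with `j ∈ I` and `rᵢ` small and asymptotically commuting with a
quasicentral approximate unit `u`, and `v` vanishes near `μ`, then `v(zᵢ)` is asymptotically
supported under `u`. -/
theorem IsContractiveApproxUnit.tendsto_cfc_mul_one_sub (hu : IsContractiveApproxUnit I l u)
    {v : ℝ → ℝ} (hv : Continuous v) (hvb : ∀ t, |v t| ≤ 1) {μ η : ℝ} (hη : 0 < η)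
    (hv0 : ∀ t, |t - μ| ≤ η → v t = 0) {z r : ι → B} {j : B} (hj : j ∈ I)
    (hz : ∀ i, z i = algebraMap ℝ B μ + j + r i) (hzs : ∀ i, IsSelfAdjoint (z i))
    (hr : ∀ i, ‖r i‖ ≤ η / 2) (hrq : Tendsto (fun i => u i * r i - r i * u i) l (𝓝 0)) :
    Tendsto (fun i => cfc v (z i) * (1 - u i)) l (𝓝 0) := by
  -- A continuous substitute for 1/(t - μ), exact where `v` is nonzero and bounded by η⁻¹. It allows
  -- `v(z)` to be factored through z - μ = j + r.
  let w : ℝ → ℝ := fun t => (t - μ) / max ((t - μ) ^ 2) (η ^ 2)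
  have hpos : ∀ t, 0 < max ((t - μ) ^ 2) (η ^ 2) := fun t => lt_max_of_lt_right (by positivity)
  have hw : Continuous w := by
    refine Continuous.div (by fun_prop) (by fun_prop) fun t => (hpos t).ne'
  have hwb : ∀ t, |w t| ≤ η⁻¹ := by
    intro t
    rw [abs_div, abs_of_pos (hpos t), div_le_iff₀ (hpos t), inv_mul_eq_div, le_div_iff₀ hη]
    rcases le_total |t - μ| η with h | h
    · exact le_max_of_le_right (by nlinarith)
    · refine le_max_of_le_left ?_
      rw [← sq_abs]
      nlinarith
  have hwv : ∀ t, w t * v t * (t - μ) = v t := by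
    intro t
    rcases le_total |t - μ| η with h | h
    · simp [hv0 t h]
    · have h2 : η ^ 2 ≤ (t - μ) ^ 2 := by
        rw [← sq_abs (t - μ)]
        gcongr
      have h3 : t - μ ≠ 0 := abs_pos.1 (hη.trans_le h)
      simp only [w, max_eq_left h2]
      field_simp
  set G : ι → B := fun i => cfc w (z i) * cfc v (z i) with hG
  have hnv : ∀ i, ‖cfc v (z i)‖ ≤ 1 := fun i => norm_cfc_le zero_le_one fun t _ => hvb t
  have hnw : ∀ i, ‖cfc w (z i)‖ ≤ η⁻¹ := fun i => norm_cfc_le (by positivity) fun t _ => hwb t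
  have hnG : ∀ i, ‖G i‖ ≤ η⁻¹ := by
    intro i
    refine (norm_mul_le _ _).trans ?_
    have : (0 : ℝ) ≤ η⁻¹ := by positivity
    nlinarith [hnv i, hnw i, norm_nonneg (cfc w (z i)), norm_nonneg (cfc v (z i))]
  have hvG : ∀ i, cfc v (z i) = G i * (j + r i) := by
    intro i
    have hzi := hzs i
    have e : j + r i = cfc (fun t => t - μ) (z i) := by
      rw [cfc_sub (fun t : ℝ => t) (fun _ => μ) (z i) (by fun_prop) (by fun_prop), cfc_id' ℝ (z i),
        cfc_const μ (z i), hz i]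
      abel
    rw [e, hG]
    simp only
    rw [← cfc_mul w v (z i) (by fun_prop) (by fun_prop),
      ← cfc_mul (fun t => w t * v t) (fun t => t - μ) (z i) (by fun_prop) (by fun_prop)]
    simp only [hwv]
  have hbound : ∀ i, ‖cfc v (z i) * (1 - u i)‖ ≤
      2 * η⁻¹ * (‖j - j * u i‖ + ‖u i * r i - r i * u i‖) := by
    intro i
    -- Moving `r i` past `1 - u i` makes the quantity being estimated reappear in the middle term,
    -- with coefficient at most η⁻¹ * (η / 2) = 1/2, so it can be absorbed on the left.
    have e : cfc v (z i) * (1 - u i) = G i * (j - j * u i) +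
        cfc w (z i) * (cfc v (z i) * (1 - u i)) * r i + G i * (u i * r i - r i * u i) := by
      nth_rw 1 [hvG i]
      simp only [hG]
      noncomm_ring
    set X := ‖cfc v (z i) * (1 - u i)‖ with hX
    have h1 : X ≤ η⁻¹ * ‖j - j * u i‖ + η⁻¹ * X * (η / 2) + η⁻¹ * ‖u i * r i - r i * u i‖ := by
      rw [hX]
      nth_rw 1 [e]
      refine (norm_add_le _ _).trans (add_le_add ((norm_add_le _ _).trans (add_le_add ?_ ?_)) ?_)
      · exact (norm_mul_le _ _).trans (by gcongr; exact hnG i)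
      · refine (norm_mul_le _ _).trans ?_
        gcongr
        · exact (norm_mul_le _ _).trans (by gcongr; exact hnw i)
        · exact hr i
      · exact (norm_mul_le _ _).trans (by gcongr; exact hnG i)
    have h2 : η⁻¹ * X * (η / 2) = X / 2 := by field_simp
    rw [h2] at h1
    linarith
  refine squeeze_zero_norm hbound ?_
  have h1 : Tendsto (fun i => ‖j - j * u i‖) l (𝓝 0) := by
    have := (tendsto_const_nhds (x := j)).sub (hu.tendsto_mul_right hj)
    simpa using this.norm
  simpa using (h1.add hrq.norm).const_mul (2 * η⁻¹)

theorem IsContractiveApproxUnit.tendsto_mul_mul_one_sub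
    (hq : ∀ a, Tendsto (fun i => u i * a - a * u i) l (𝓝 0))
    {F : ι → B} (hF : ∀ i, ‖F i‖ ≤ 1) (hFu : Tendsto (fun i => F i * (1 - u i)) l (𝓝 0)) (h : B) :
    Tendsto (fun i => F i * h * (1 - u i)) l (𝓝 0) := by
  have e : (fun i => F i * h * (1 - u i)) =
      fun i => F i * (1 - u i) * h + F i * (u i * h - h * u i) := by
    funext i
    noncomm_ring
  rw [e]
  simpa using (hFu.mul_const h).add (tendsto_mul_zero_of_norm_le (hq h) hF)

/-- Behind `F`, cutting `y` down to `u y u` makes no difference in the limit: quasicentrality moves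
`1 - u` leftwards until it meets `F`. The intermediate factor `h` is needed to compare products. -/
theorem IsContractiveApproxUnit.tendsto_mul_mul_conj_sub (hu : IsContractiveApproxUnit I l u)
    (hq : ∀ a, Tendsto (fun i => u i * a - a * u i) l (𝓝 0))
    {F : ι → B} (hF : ∀ i, ‖F i‖ ≤ 1) (hFu : Tendsto (fun i => F i * (1 - u i)) l (𝓝 0))
    (h y : B) :
    Tendsto (fun i => F i * h * (u i * y * u i - y)) l (𝓝 0) := by
  have e : (fun i => F i * h * (u i * y * u i - y)) =
      fun i => -(F i * h * (1 - u i) * y * u i + F i * (h * y) * (1 - u i)) := by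
    funext i
    noncomm_ring
  rw [e]
  have h1 := (tendsto_mul_mul_one_sub hq hF hFu h).mul_const y
  rw [zero_mul] at h1
  simpa using ((tendsto_zero_mul_of_norm_le h1 hu.norm_le).add
    (tendsto_mul_mul_one_sub hq hF hFu (h * y))).neg

theorem IsContractiveApproxUnit.tendsto_commutator_mul {u : ι → B} {M N : ℝ} {x y : ι → B}
    (hx : ∀ i, ‖x i‖ ≤ M) (hy : ∀ i, ‖y i‖ ≤ N)
    (hxq : Tendsto (fun i => u i * x i - x i * u i) l (𝓝 0))
    (hyq : Tendsto (fun i => u i * y i - y i * u i) l (𝓝 0)) :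
    Tendsto (fun i => u i * (x i * y i) - (x i * y i) * u i) l (𝓝 0) := by
  have e : (fun i => u i * (x i * y i) - (x i * y i) * u i) =
      fun i => (u i * x i - x i * u i) * y i + x i * (u i * y i - y i * u i) := by
    funext i
    noncomm_ring
  rw [e]
  simpa using (tendsto_zero_mul_of_norm_le hxq hy).add (tendsto_mul_zero_of_norm_le hyq hx)

end

/-! ### Perturbing tuples inside ℂ + I. -/

section

variable {B : Type*} [CStarAlgebra B]

theorem cfc_mem_of_isClosed {S : NonUnitalStarSubalgebra ℂ B} (hS : IsClosed (S : Set B))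
    {f : ℝ → ℝ} (hf : Continuous f) (hf0 : f 0 = 0) {a : B} (ha : a ∈ S) :
    cfc f a ∈ S := by
  rw [← cfcₙ_eq_cfc (hf := hf.continuousOn) (hf0 := hf0)]
  have : IsClosed (S : Set B) := hS
  exact cfcₙ_mem (𝕜' := ℂ) f ha

/-- The spectrum of `s` avoids a ball around 0, so some continuous function vanishing at 0, as a
non-unital algebra requires, equals 1 on the spectrum. -/
theorem one_mem_of_isUnit {S : NonUnitalStarSubalgebra ℂ B} (hS : IsClosed (S : Set B))
    {s : B} (hs : s ∈ S) (hsa : IsSelfAdjoint s) (hu : IsUnit s) : (1 : B) ∈ S := by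
  have h0 : (0 : ℝ) ∈ (spectrum ℝ s)ᶜ := fun h => (spectrum.zero_mem_iff ℝ).1 h hu
  obtain ⟨ρ, hρ, hball⟩ := Metric.isOpen_iff.1 (spectrum.isClosed s).isOpen_compl 0 h0
  have h1 : cfc (fun t : ℝ => min 1 (|t| / ρ)) s = 1 := by
    rw [← cfc_const_one ℝ s]
    refine cfc_congr fun t ht => ?_
    refine min_eq_left ?_
    rw [one_le_div hρ]
    by_contra! hlt
    exact hball (by simpa using hlt) ht
  rw [← h1]
  exact cfc_mem_of_isClosed hS (by fun_prop) (by simp) hs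

theorem isSelfAdjoint_sum_mul_self {n : ℕ} {b : Fin n → B} (hb : ∀ i, IsSelfAdjoint (b i)) :
    IsSelfAdjoint (∑ i, b i * b i) :=
  sum_mem (S := selfAdjoint B) fun i _ => by
    rw [selfAdjoint.mem_iff, star_mul, (hb i).star_eq]

variable {I : NonUnitalStarSubalgebra ℂ B} {ι : Type*} {l : Filter ι} {u : ι → B}

theorem IsContractiveApproxUnit.isSelfAdjoint_conj (hu : IsContractiveApproxUnit I l u) (i : ι)
    {y : B} (hy : IsSelfAdjoint y) : IsSelfAdjoint (u i * y * u i) := by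
  rw [isSelfAdjoint_iff, star_mul, star_mul, (hu.isSelfAdjoint i).star_eq, hy.star_eq, mul_assoc]

theorem IsContractiveApproxUnit.conj_mem (hI : IsClosedIdeal I)
    (hu : IsContractiveApproxUnit I l u) (i : ι) (y : B) : u i * y * u i ∈ I :=
  hI.mul_mem_left _ (hu.mem i)

/-- The perturbation `pⱼ ↦ pⱼ + u yⱼ u` changes `Σ pⱼ²` by a small amount that asymptotically
commutes with `u`. -/
theorem IsContractiveApproxUnit.exists_sum_sq_add_conj (hu : IsContractiveApproxUnit I l u)
    (hq : ∀ a, Tendsto (fun i => u i * a - a * u i) l (𝓝 0)) {n : ℕ} (p y : Fin n → B) {ε : ℝ}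
    (hε1 : ε ≤ 1) (hy : ∀ j, ‖y j‖ ≤ ε) :
    ∃ r : ι → B, (∀ i, ∑ j, (p j + u i * y j * u i) * (p j + u i * y j * u i) =
        (∑ j, p j * p j) + r i) ∧ (∀ i, ‖r i‖ ≤ (∑ j, (2 * ‖p j‖ + 1)) * ε) ∧
      Tendsto (fun i => u i * r i - r i * u i) l (𝓝 0) := by
  have hc : ∀ i j, ‖u i * y j * u i‖ ≤ ε := fun i j => (hu.norm_conj_le i _).trans (hy j)
  refine ⟨fun i => ∑ j, (p j * (u i * y j * u i) + u i * y j * u i * p j +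
    u i * y j * u i * (u i * y j * u i)), fun i => ?_, fun i => ?_, ?_⟩
  · rw [← Finset.sum_add_distrib]
    refine Finset.sum_congr rfl fun j _ => ?_
    simp only [add_mul, mul_add]
    abel
  · rw [Finset.sum_mul]
    refine (norm_sum_le _ _).trans (Finset.sum_le_sum fun j _ => ?_)
    have h1 := norm_mul_le (p j) (u i * y j * u i)
    have h2 := norm_mul_le (u i * y j * u i) (p j)
    have h3 := norm_mul_le (u i * y j * u i) (u i * y j * u i)
    have h4 := hc i j
    have h5 := norm_nonneg (u i * y j * u i)
    have h6 := norm_nonneg (p j)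
    refine (norm_add_le _ _).trans ((add_le_add (norm_add_le _ _) le_rfl).trans ?_)
    nlinarith
  · have hcq : ∀ j, Tendsto (fun i => u i * (u i * y j * u i) - u i * y j * u i * u i) l (𝓝 0) := by
      intro j
      have e : (fun i => u i * (u i * y j * u i) - u i * y j * u i * u i) =
          fun i => u i * (u i * y j - y j * u i) * u i := by
        funext i
        noncomm_ring
      rw [e]
      exact tendsto_zero_mul_of_norm_le (tendsto_mul_zero_of_norm_le (hq _) hu.norm_le) hu.norm_le
    have e : (fun i => u i * (∑ j, (p j * (u i * y j * u i) + u i * y j * u i * p j +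
        u i * y j * u i * (u i * y j * u i))) - (∑ j, (p j * (u i * y j * u i) +
        u i * y j * u i * p j + u i * y j * u i * (u i * y j * u i))) * u i) = fun i => ∑ j,
        ((u i * (p j * (u i * y j * u i)) - p j * (u i * y j * u i) * u i) +
         (u i * (u i * y j * u i * p j) - u i * y j * u i * p j * u i) +
         (u i * (u i * y j * u i * (u i * y j * u i)) -
          u i * y j * u i * (u i * y j * u i) * u i)) := by
      funext i
      rw [Finset.mul_sum, Finset.sum_mul, ← Finset.sum_sub_distrib]
      refine Finset.sum_congr rfl fun j _ => ?_
      simp only [add_mul, mul_add]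
      abel
    rw [e, show (0 : B) = ∑ _j : Fin n, (0 + 0 + 0 : B) by simp]
    refine tendsto_finsetSum _ fun j _ => ?_
    exact ((tendsto_commutator_mul (fun _ => le_rfl) (fun i => hc i j) (hq _) (hcq j)).add
      (tendsto_commutator_mul (fun i => hc i j) (fun _ => le_rfl) (hcq j) (hq _))).add
      (tendsto_commutator_mul (fun i => hc i j) (fun i => hc i j) (hcq j) (hcq j))

/-- The element `W i` is the polynomial `w` evaluated at `b' i` instead of `b`. Quantifying over `h`
makes the product step work: Fh(VW - xy) = Fh(V - x)W + F(hx)(W - y). -/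
theorem exists_net_of_mem_adjoin {n : ℕ} {b : Fin n → B} (hb : ∀ j, IsSelfAdjoint (b j))
    {b' : ι → Fin n → B} {S : ι → NonUnitalStarSubalgebra ℂ B} (hS : ∀ i j, b' i j ∈ S i)
    (hbd : ∀ j, ∃ M, ∀ i, ‖b' i j‖ ≤ M) {F : ι → B}
    (hlim : ∀ j h, Tendsto (fun i => F i * h * (b' i j - b j)) l (𝓝 0)) {w : B}
    (hw : w ∈ NonUnitalStarAlgebra.adjoin ℂ (Set.range b)) :
    ∃ W : ι → B, (∀ i, W i ∈ S i) ∧ (∃ M, ∀ i, ‖W i‖ ≤ M) ∧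
      ∀ h, Tendsto (fun i => F i * h * (W i - w)) l (𝓝 0) := by
  refine mem_adjoin_range_induction hb
    (p := fun w => ∃ W : ι → B, (∀ i, W i ∈ S i) ∧ (∃ M, ∀ i, ‖W i‖ ≤ M) ∧
      ∀ h, Tendsto (fun i => F i * h * (W i - w)) l (𝓝 0)) ?_ ?_ ?_ ?_ ?_ hw
  · exact fun j => ⟨fun i => b' i j, fun i => hS i j, hbd j, hlim j⟩
  · exact ⟨fun _ => 0, fun i => zero_mem _, ⟨0, by simp⟩, fun h => by
      simpa using tendsto_const_nhds⟩
  · rintro x y ⟨V, hV1, ⟨M, hM⟩, hV⟩ ⟨W, hW1, ⟨N, hN⟩, hW⟩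
    refine ⟨fun i => V i + W i, fun i => add_mem (hV1 i) (hW1 i),
      ⟨M + N, fun i => (norm_add_le _ _).trans (add_le_add (hM i) (hN i))⟩, fun h => ?_⟩
    have := (hV h).add (hW h)
    rw [add_zero] at this
    refine this.congr fun i => ?_
    rw [← mul_add, add_sub_add_comm]
  · rintro x y ⟨V, hV1, ⟨M, hM⟩, hV⟩ ⟨W, hW1, ⟨N, hN⟩, hW⟩
    refine ⟨fun i => V i * W i, fun i => mul_mem (hV1 i) (hW1 i), ⟨M * N, fun i => ?_⟩,
      fun h => ?_⟩
    · refine (norm_mul_le _ _).trans ?_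
      have := (norm_nonneg _).trans (hM i)
      gcongr
      · exact hM i
      · exact hN i
    · have := (tendsto_zero_mul_of_norm_le (hV h) hN).add (hW (h * x))
      rw [add_zero] at this
      refine this.congr fun i => ?_
      noncomm_ring
  · rintro c x ⟨V, hV1, ⟨M, hM⟩, hV⟩
    refine ⟨fun i => c • V i, fun i => SMulMemClass.smul_mem _ (hV1 i), ⟨‖c‖ * M, fun i => ?_⟩,
      fun h => ?_⟩
    · rw [norm_smul]
      exact mul_le_mul_of_nonneg_left (hM i) (norm_nonneg _)
    · have := (hV h).const_smul c
      rw [smul_zero] at this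
      refine this.congr fun i => ?_
      rw [← smul_sub, mul_smul_comm]

theorem isSelfAdjoint_algebraMap_real (t : ℝ) : IsSelfAdjoint (algebraMap ℝ B t) :=
  IsSelfAdjoint.algebraMap B (.all t)

/-- Tuples `μ + x` with `x` in the ideal and `μ ≠ 0` can be perturbed inside the ideal so as to
make the sum of squares invertible. -/
theorem exists_isUnit_sum_sq_near (hI : IsClosedIdeal I) {n : ℕ} (hB : Dense (genSA B n))
    {μ : Fin n → ℝ} (hμ : 0 < ∑ j, μ j * μ j) {x : Fin n → B} (hxI : ∀ j, x j ∈ I)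
    (hx : ∀ j, IsSelfAdjoint (x j)) {ε : ℝ} (hε : 0 < ε) :
    ∃ x' : Fin n → B, (∀ j, x' j ∈ I) ∧ (∀ j, IsSelfAdjoint (x' j)) ∧ (∀ j, ‖x' j - x j‖ < ε) ∧
      IsUnit (∑ j, (algebraMap ℝ B (μ j) + x' j) * (algebraMap ℝ B (μ j) + x' j)) := by
  classical
  obtain ⟨u, hu, hq⟩ := exists_quasicentral hI
  set p : Fin n → B := fun j => algebraMap ℝ B (μ j) + x j with hp
  have hps : ∀ j, IsSelfAdjoint (p j) := fun j => (isSelfAdjoint_algebraMap_real _).add (hx j)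
  set m := ∑ j, μ j * μ j with hm
  set K := ∑ j, (2 * ‖p j‖ + 1) with hK
  have hK0 : 0 ≤ K := Finset.sum_nonneg fun j _ => by positivity
  -- The last bound keeps the error `r` below η/2 with η = m/2, as the cut-off lemma around the
  -- scalar `m` demands.
  obtain ⟨ε', hε', h1, h2, h3⟩ : ∃ ε' > 0, ε' ≤ ε ∧ ε' ≤ 1 ∧ K * ε' ≤ m / 2 / 2 := by
    refine ⟨min (min ε 1) (m / 4 / (K + 1)), by positivity, (min_le_left _ _).trans (min_le_left _ _),
      (min_le_left _ _).trans (min_le_right _ _), ?_⟩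
    calc K * min (min ε 1) (m / 4 / (K + 1)) ≤ (K + 1) * (m / 4 / (K + 1)) := by
          gcongr
          · linarith
          · exact min_le_right _ _
      _ = m / 2 / 2 := by field_simp; norm_num
  obtain ⟨b, hb, hbp, hgen⟩ := exists_generates_of_dense hB hps hε'
  set y : Fin n → B := fun j => b j - p j with hy
  have hys : ∀ j, IsSelfAdjoint (y j) := fun j => (hb j).sub (hps j)
  set s := ∑ j, b j * b j with hs
  have hsu : IsUnit s := isUnit_sum_sq_of_generates hb hgen
  obtain ⟨s', hs'⟩ := hsu.exists_right_inv
  obtain ⟨r, hr1, hr2, hr3⟩ := hu.exists_sum_sq_add_conj hq p y h2 fun j => (hbp j).le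
  set b' : Finset B × ℕ → Fin n → B := fun i j => p j + u i * y j * u i with hb'
  have hb's : ∀ i j, IsSelfAdjoint (b' i j) := fun i j =>
    (hps j).add (hu.isSelfAdjoint_conj i (hys j))
  set z : Finset B × ℕ → B := fun i => ∑ j, b' i j * b' i j with hz
  have hzs : ∀ i, IsSelfAdjoint (z i) := fun i => isSelfAdjoint_sum_mul_self (hb's i)
  set j0 : B := ∑ j, (algebraMap ℝ B (μ j) * x j + x j * p j) with hj0
  have hj0I : j0 ∈ I := sum_mem fun j _ =>
    add_mem (hI.mul_mem_left _ (hxI j)) (hI.mul_mem_right _ (hxI j))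
  have hpp : ∑ j, p j * p j = algebraMap ℝ B m + j0 := by
    rw [hm, map_sum, hj0, ← Finset.sum_add_distrib]
    refine Finset.sum_congr rfl fun j _ => ?_
    simp only [hp, map_mul]
    noncomm_ring
  -- The bound c ≤ m/2 makes the tent `v` vanish within m/2 of `m`; the other makes v(z) z s' at
  -- most 1/4 in norm.
  obtain ⟨c, hc0, hcm, hcs⟩ : ∃ c > 0, c ≤ m / 2 ∧ c * ‖s'‖ ≤ 1 / 4 := by
    refine ⟨min (m / 2) (1 / (4 * (‖s'‖ + 1))), by positivity, min_le_left _ _, ?_⟩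
    calc min (m / 2) (1 / (4 * (‖s'‖ + 1))) * ‖s'‖ ≤ 1 / (4 * (‖s'‖ + 1)) * (‖s'‖ + 1) := by
          gcongr
          · exact min_le_right _ _
          · linarith
      _ = 1 / 4 := by field_simp
  let v : ℝ → ℝ := fun t => max 0 (1 - |t| / c)
  have hv : Continuous v := by fun_prop
  have hvb : ∀ t, |v t| ≤ 1 := by
    intro t
    have : 0 ≤ |t| / c := by positivity
    rw [abs_of_nonneg (le_max_left _ _)]
    exact max_le zero_le_one (by linarith)
  have hv0 : ∀ t, c ≤ |t| → v t = 0 := by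
    intro t ht
    refine max_eq_left ?_
    rw [sub_nonpos, one_le_div hc0]
    exact ht
  have hF : ∀ i, ‖cfc v (z i)‖ ≤ 1 := fun i => norm_cfc_le zero_le_one fun t _ => hvb t
  have hFu : Tendsto (fun i => cfc v (z i) * (1 - u i)) atTop (𝓝 0) := by
    refine hu.tendsto_cfc_mul_one_sub hv hvb (μ := m) (η := m / 2) (by positivity) ?_ hj0I
      (z := z) (r := r) (fun i => ?_) hzs (fun i => (hr2 i).trans h3) hr3
    · intro t ht
      refine hv0 t ?_
      have := (abs_le.1 ht).1
      rw [abs_of_nonneg (by linarith)]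
      linarith
    · rw [← hpp, ← hr1]
  -- Under the cut-off, `z i` agrees asymptotically with the invertible `s`.
  have hlim : Tendsto (fun i => cfc v (z i) * (z i - s)) atTop (𝓝 0) := by
    have e : (fun i => cfc v (z i) * (z i - s)) = fun i => ∑ j,
        (cfc v (z i) * 1 * (u i * y j * u i - y j) * b' i j +
          cfc v (z i) * b j * (u i * y j * u i - y j)) := by
      funext i
      simp only [hz, hs]
      rw [← Finset.sum_sub_distrib, Finset.mul_sum]
      refine Finset.sum_congr rfl fun j _ => ?_
      have e1 : u i * y j * u i - y j = b' i j - b j := by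
        simp only [hb', hy]
        abel
      rw [e1]
      noncomm_ring
    rw [e, show (0 : B) = ∑ _j : Fin n, (0 + 0 : B) by simp]
    refine tendsto_finsetSum _ fun j _ => ?_
    refine (tendsto_zero_mul_of_norm_le (hu.tendsto_mul_mul_conj_sub hq hF hFu 1 (y j))
      (M := ‖p j‖ + ‖y j‖) fun i => ?_).add (hu.tendsto_mul_mul_conj_sub hq hF hFu (b j) (y j))
    exact (norm_add_le _ _).trans (add_le_add le_rfl (hu.norm_conj_le _ _))
  have hlim2 := (hlim.mul_const s').norm
  rw [zero_mul, norm_zero] at hlim2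
  obtain ⟨i, hi⟩ := (hlim2.eventually (gt_mem_nhds (show (0 : ℝ) < 1 / 4 by norm_num))).exists
  have hvz : ‖cfc v (z i) * z i‖ ≤ c := by
    have hzi := hzs i
    nth_rw 2 [← cfc_id' ℝ (z i)]
    rw [← cfc_mul v (fun t => t) (z i) (by fun_prop) (by fun_prop)]
    refine norm_cfc_le hc0.le fun t _ => ?_
    rw [Real.norm_eq_abs, abs_mul]
    rcases le_total c |t| with h | h
    · simp [hv0 t h, hc0.le]
    · calc |v t| * |t| ≤ 1 * c := by gcongr; exact hvb t
        _ = c := one_mul c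
  have hvlt : ‖cfc v (z i)‖ < 1 := by
    have e : cfc v (z i) = cfc v (z i) * z i * s' - cfc v (z i) * (z i - s) * s' := by
      rw [← sub_mul, ← mul_sub, sub_sub_cancel, mul_assoc, hs', mul_one]
    rw [e]
    refine (norm_sub_le _ _).trans_lt ?_
    have h5 : ‖cfc v (z i) * z i * s'‖ ≤ c * ‖s'‖ :=
      (norm_mul_le _ _).trans (by gcongr)
    linarith
  refine ⟨fun j => x j + u i * y j * u i, fun j => add_mem (hxI j) (hu.conj_mem hI i _),
    fun j => (hx j).add (hu.isSelfAdjoint_conj i (hys j)), fun j => ?_, ?_⟩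
  · simp only [add_sub_cancel_left]
    exact ((hu.norm_conj_le i _).trans_lt (hbp j)).trans_le h1
  · have e : ∑ j, (algebraMap ℝ B (μ j) + (x j + u i * y j * u i)) *
        (algebraMap ℝ B (μ j) + (x j + u i * y j * u i)) = z i := by
      simp only [hz, hb', hp, add_assoc]
    rw [e]
    by_contra hnu
    have h6 := norm_apply_le_norm_cfc v (z i) ((spectrum.zero_mem_iff ℝ).2 hnu) hv.continuousOn
      (hzs i)
    have h7 : v 0 = 1 := by simp [v]
    rw [h7, norm_one] at h6
    linarith

theorem exists_sum_sq_mul_near (hI : IsClosedIdeal I) {n : ℕ} (hB : Dense (genSA B n))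
    {x : Fin n → B} (hxI : ∀ j, x j ∈ I) (hx : ∀ j, IsSelfAdjoint (x j)) {c : B} (hc : c ∈ I)
    {ε δ : ℝ} (hε : 0 < ε) (hδ : 0 < δ) :
    ∃ x' : Fin n → B, (∀ j, x' j ∈ I) ∧ (∀ j, IsSelfAdjoint (x' j)) ∧ (∀ j, ‖x' j - x j‖ < ε) ∧
      ∃ k, ‖(∑ j, x' j * x' j) * k - c‖ < δ := by
  classical
  obtain ⟨u, hu, hq⟩ := exists_quasicentral hI
  obtain ⟨b, hb, hbp, hgen⟩ := exists_generates_of_dense hB hx hε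
  set y : Fin n → B := fun j => b j - x j with hy
  have hys : ∀ j, IsSelfAdjoint (y j) := fun j => (hb j).sub (hx j)
  obtain ⟨s', hs'⟩ := (isUnit_sum_sq_of_generates hb hgen).exists_right_inv
  have hconv : ∀ j, ∀ k ∈ I, Tendsto (fun i => (x j + u i * y j * u i) * k) atTop (𝓝 (b j * k)) := by
    intro j k hk
    have e : (fun i => (x j + u i * y j * u i) * k) =
        fun i => x j * k + (u i * y j * (u i * k - k) + u i * (y j * k)) := by
      funext i
      noncomm_ring
    have h1 : Tendsto (fun i => u i * k - k) atTop (𝓝 0) := 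
      tendsto_sub_nhds_zero_iff.2 (hu.tendsto_mul k hk)
    have h2 : Tendsto (fun i => u i * y j * (u i * k - k)) atTop (𝓝 0) :=
      tendsto_mul_zero_of_norm_le (M := ‖y j‖) h1 fun i => by
        refine (norm_mul_le _ _).trans ?_
        have := hu.norm_le i
        nlinarith [norm_nonneg (y j)]
    rw [e]
    have h3 := (h2.add (hu.tendsto_mul _ (hI.mul_mem_left (y j) hk))).const_add (x j * k)
    have e2 : x j * k + (0 + y j * k) = b j * k := by
      simp only [hy]
      noncomm_ring
    rwa [e2] at h3
  have hk : s' * c ∈ I := hI.mul_mem_left _ hc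
  have hlim : Tendsto (fun i => (∑ j, (x j + u i * y j * u i) * (x j + u i * y j * u i)) *
      (s' * c)) atTop (𝓝 c) := by
    have e : c = ∑ j, b j * (b j * (s' * c)) := by
      simp only [← mul_assoc, ← Finset.sum_mul, hs', one_mul]
    simp only [Finset.sum_mul]
    suffices h : Tendsto (fun i => ∑ j, (x j + u i * y j * u i) * (x j + u i * y j * u i) *
        (s' * c)) atTop (𝓝 (∑ j, b j * (b j * (s' * c)))) by rwa [← e] at h
    refine tendsto_finsetSum _ fun j _ => ?_
    have e2 : (fun i => (x j + u i * y j * u i) * (x j + u i * y j * u i) * (s' * c)) =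
        fun i => (x j + u i * y j * u i) * ((x j + u i * y j * u i) * (s' * c) - b j * (s' * c)) +
          (x j + u i * y j * u i) * (b j * (s' * c)) := by
      funext i
      noncomm_ring
    rw [e2]
    have h1 : Tendsto (fun i => (x j + u i * y j * u i) * (s' * c) - b j * (s' * c)) atTop
        (𝓝 0) :=
      tendsto_sub_nhds_zero_iff.2 (hconv j _ hk)
    have h2 := (tendsto_mul_zero_of_norm_le (M := ‖x j‖ + ‖y j‖)
      (g := fun i => x j + u i * y j * u i) h1 fun i =>
        (norm_add_le _ _).trans (add_le_add le_rfl (hu.norm_conj_le _ _))).add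
        (hconv j _ (hI.mul_mem_left (b j) hk))
    rwa [zero_add] at h2
  obtain ⟨i, hi⟩ := (Metric.tendsto_nhds.1 hlim δ hδ).exists
  rw [dist_eq_norm] at hi
  refine ⟨fun j => x j + u i * y j * u i, fun j => add_mem (hxI j) (hu.conj_mem hI i _),
    fun j => (hx j).add (hu.isSelfAdjoint_conj i (hys j)), fun j => ?_, _, hi⟩
  simp only [add_sub_cancel_left]
  exact (hu.norm_conj_le i _).trans_lt (hbp j)

theorem exists_near_adjoin_one (hI : IsClosedIdeal I) {n : ℕ} (hB : Dense (genSA B n))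
    (μ : Fin n → ℝ) {x : Fin n → B} (hxI : ∀ j, x j ∈ I) (hx : ∀ j, IsSelfAdjoint (x j))
    {c k : B} {ε δ : ℝ} (hε : 0 < ε) (hδ : 0 < δ) (hk : ‖(∑ j, x j * x j) * k - c‖ < δ) :
    ∃ x' : Fin n → B, (∀ j, x' j ∈ I) ∧ (∀ j, IsSelfAdjoint (x' j)) ∧ (∀ j, ‖x' j - x j‖ < ε) ∧
      ∀ S : NonUnitalStarSubalgebra ℂ B, IsClosed (S : Set B) → 1 ∈ S → (∀ j, x' j ∈ S) →
        ∃ w ∈ S, ‖w - c‖ < 4 * δ := by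
  classical
  obtain ⟨u, hu, hq⟩ := exists_quasicentral hI
  set p : Fin n → B := fun j => algebraMap ℝ B (μ j) + x j with hp
  have hps : ∀ j, IsSelfAdjoint (p j) := fun j => (isSelfAdjoint_algebraMap_real _).add (hx j)
  set g := ∑ j, x j * x j with hg
  have hgI : g ∈ I := sum_mem fun j _ => hI.mul_mem_left _ (hxI j)
  set K := ∑ j, (2 * ‖x j‖ + 1) with hK
  have hK0 : 0 ≤ K := Finset.sum_nonneg fun j _ => by positivity
  obtain ⟨η, hη, hηk⟩ : ∃ η > 0, 3 * η * ‖k‖ ≤ δ := by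
    refine ⟨δ / (3 * (‖k‖ + 1)), by positivity, ?_⟩
    calc 3 * (δ / (3 * (‖k‖ + 1))) * ‖k‖ ≤ 3 * (δ / (3 * (‖k‖ + 1))) * (‖k‖ + 1) := by
          gcongr
          linarith
      _ = δ := by field_simp
  obtain ⟨ε', hε', h1, h2, h3⟩ : ∃ ε' > 0, ε' ≤ ε ∧ ε' ≤ 1 ∧ K * ε' ≤ η / 2 := by
    refine ⟨min (min ε 1) (η / 2 / (K + 1)), by positivity, (min_le_left _ _).trans (min_le_left _ _),
      (min_le_left _ _).trans (min_le_right _ _), ?_⟩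
    calc K * min (min ε 1) (η / 2 / (K + 1)) ≤ (K + 1) * (η / 2 / (K + 1)) := by
          gcongr
          · linarith
          · exact min_le_right _ _
      _ = η / 2 := by field_simp
  obtain ⟨b, hb, hbp, hgen⟩ := exists_generates_of_dense hB hps hε'
  set y : Fin n → B := fun j => b j - p j with hy
  have hys : ∀ j, IsSelfAdjoint (y j) := fun j => (hb j).sub (hps j)
  obtain ⟨r, hr1, hr2, hr3⟩ := hu.exists_sum_sq_add_conj hq x y h2 fun j => (hbp j).le
  set x' : Finset B × ℕ → Fin n → B := fun i j => x j + u i * y j * u i with hx'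
  have hx's : ∀ i j, IsSelfAdjoint (x' i j) := fun i j =>
    (hx j).add (hu.isSelfAdjoint_conj i (hys j))
  set z : Finset B × ℕ → B := fun i => ∑ j, x' i j * x' i j with hz
  have hzs : ∀ i, IsSelfAdjoint (z i) := fun i => isSelfAdjoint_sum_mul_self (hx's i)
  let v : ℝ → ℝ := fun t => min 1 (max 0 (|t| / η - 1))
  have hv : Continuous v := by fun_prop
  have hvnn : ∀ t, 0 ≤ v t := fun t => le_min zero_le_one (le_max_left _ _)
  have hv1 : ∀ t, v t ≤ 1 := fun t => min_le_left _ _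
  have hvb : ∀ t, |v t| ≤ 1 := fun t => by rw [abs_of_nonneg (hvnn t)]; exact hv1 t
  have hv0 : ∀ t, |t| ≤ η → v t = 0 := by
    intro t ht
    have : |t| / η - 1 ≤ 0 := by rw [sub_nonpos, div_le_one hη]; exact ht
    simp [v, max_eq_left this]
  have hvone : ∀ t, 2 * η ≤ |t| → v t = 1 := by
    intro t ht
    refine min_eq_left (le_max_of_le_right ?_)
    rw [le_sub_iff_add_le, le_div_iff₀ hη]
    linarith
  have hF : ∀ i, ‖cfc v (z i)‖ ≤ 1 := fun i => norm_cfc_le zero_le_one fun t _ => hvb t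
  have hFu : Tendsto (fun i => cfc v (z i) * (1 - u i)) atTop (𝓝 0) := by
    refine hu.tendsto_cfc_mul_one_sub hv hvb (μ := 0) hη (fun t ht => hv0 t (by simpa using ht))
      hgI (z := z) (r := r) (fun i => ?_) hzs (fun i => (hr2 i).trans h3) hr3
    rw [map_zero, zero_add, ← hr1]
  set T : Finset B × ℕ → NonUnitalStarSubalgebra ℂ B := fun i =>
    (NonUnitalStarAlgebra.adjoin ℂ (insert 1 (Set.range (x' i)))).topologicalClosure with hT
  have hTc : ∀ i, IsClosed (T i : Set B) := fun i =>
    NonUnitalStarSubalgebra.isClosed_topologicalClosure _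
  have hTsub : ∀ i, insert 1 (Set.range (x' i)) ⊆ (T i : Set B) := fun i =>
    (NonUnitalStarAlgebra.subset_adjoin ℂ _).trans
      (NonUnitalStarSubalgebra.le_topologicalClosure _)
  have hT1 : ∀ i, 1 ∈ T i := fun i => hTsub i (Set.mem_insert _ _)
  have hTx : ∀ i j, x' i j ∈ T i := fun i j => hTsub i (Set.mem_insert_of_mem _ ⟨j, rfl⟩)
  have hcmem : c ∈ cstarGenerated b := hgen ▸ trivial
  obtain ⟨w, hw, hwc⟩ := Metric.mem_closure_iff.1 hcmem δ hδ
  rw [dist_eq_norm, norm_sub_rev] at hwc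
  obtain ⟨W, hWT, -, hW⟩ := exists_net_of_mem_adjoin (l := atTop) hb
    (b' := fun i j => algebraMap ℝ B (μ j) + x' i j) (S := T) (F := fun i => cfc v (z i))
    (fun i j => by
      refine add_mem ?_ (hTx i j)
      rw [Algebra.algebraMap_eq_smul_one, ← Complex.coe_smul]
      exact SMulMemClass.smul_mem _ (hT1 i))
    (fun j => ⟨‖algebraMap ℝ B (μ j)‖ + (‖x j‖ + ‖y j‖), fun i => (norm_add_le _ _).trans
      (add_le_add le_rfl ((norm_add_le _ _).trans (add_le_add le_rfl (hu.norm_conj_le _ _))))⟩)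
    (fun j h => by
      refine (hu.tendsto_mul_mul_conj_sub hq hF hFu h (y j)).congr fun i => ?_
      congr 1
      simp only [hx', hy, hp]
      abel) hw
  have hWn := (hW 1).norm
  rw [norm_zero] at hWn
  obtain ⟨i, hi⟩ := (hWn.eventually (gt_mem_nhds hδ)).exists
  rw [mul_one] at hi
  refine ⟨x' i, fun j => add_mem (hxI j) (hu.conj_mem hI i _), hx's i, fun j => ?_, ?_⟩
  · simp only [hx', add_sub_cancel_left]
    exact ((hu.norm_conj_le i _).trans_lt (hbp j)).trans_le h1
  intro S hS hS1 hSx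
  have hTS : T i ≤ S := by
    refine NonUnitalStarSubalgebra.topologicalClosure_minimal _ ?_ hS
    rw [NonUnitalStarAlgebra.adjoin_le_iff]
    rintro _ (rfl | ⟨j, rfl⟩)
    · exact hS1
    · exact hSx j
  have hzS : z i ∈ S := sum_mem fun j _ => mul_mem (hSx j) (hSx j)
  refine ⟨cfc v (z i) * W i, mul_mem (cfc_mem_of_isClosed hS hv (hv0 0 (by simp [hη.le])) hzS) (hTS (hWT i)), ?_⟩
  set f := cfc v (z i) with hf
  have hzi := hzs i
  have h1f : 1 - f = cfc (fun t => 1 - v t) (z i) := by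
    rw [cfc_sub (fun _ : ℝ => (1 : ℝ)) v (z i) (by fun_prop) (by fun_prop), cfc_const_one ℝ (z i)]
  have hn1 : ‖1 - f‖ ≤ 1 := by
    rw [h1f]
    refine norm_cfc_le zero_le_one fun t _ => ?_
    rw [Real.norm_eq_abs, abs_of_nonneg (by linarith [hv1 t])]
    linarith [hvnn t]
  have hn2 : ‖(1 - f) * z i‖ ≤ 2 * η := by
    rw [h1f]
    nth_rw 2 [← cfc_id' ℝ (z i)]
    rw [← cfc_mul (fun t => 1 - v t) (fun t => t) (z i) (by fun_prop) (by fun_prop)]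
    refine norm_cfc_le (by positivity) fun t _ => ?_
    rw [Real.norm_eq_abs, abs_mul, abs_of_nonneg (show 0 ≤ 1 - v t by linarith [hv1 t])]
    rcases le_total (2 * η) |t| with h | h
    · rw [hvone t h]
      simp [hη.le]
    · nlinarith [hvnn t, abs_nonneg t]
  have e : f * W i - c = f * (W i - w) + f * (w - c) + (1 - f) * (g * k - c) +
      (1 - f) * r i * k - (1 - f) * z i * k := by
    have : z i = g + r i := hr1 i
    rw [this]
    noncomm_ring
  have b1 : ‖f * (w - c)‖ ≤ δ := by
    refine (norm_mul_le _ _).trans ?_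
    nlinarith [hF i, norm_nonneg (w - c)]
  have b2 : ‖(1 - f) * (g * k - c)‖ < δ := by
    refine (norm_mul_le _ _).trans_lt ?_
    nlinarith [norm_nonneg (g * k - c)]
  have b3 : ‖(1 - f) * r i * k‖ ≤ η / 2 * ‖k‖ := by
    refine (norm_mul_le _ _).trans ?_
    gcongr
    refine (norm_mul_le _ _).trans ?_
    nlinarith [norm_nonneg (r i), (hr2 i).trans h3]
  have b4 : ‖(1 - f) * z i * k‖ ≤ 2 * η * ‖k‖ := by
    refine (norm_mul_le _ _).trans ?_
    gcongr
  have b5 : 0 ≤ η * ‖k‖ := by positivity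
  rw [e]
  refine (norm_sub_le _ _).trans_lt ?_
  refine (add_le_add (norm_add_le _ _) le_rfl).trans_lt ?_
  refine (add_le_add (add_le_add (norm_add_le _ _) le_rfl) le_rfl).trans_lt ?_
  refine (add_le_add (add_le_add (add_le_add (norm_add_le _ _) le_rfl) le_rfl) le_rfl).trans_lt ?_
  linarith

/-- Tuples in `ℝ + I_sa` generating a C⋆-algebra that contains a given element of `ℂ + I` up to
`δ` are dense. -/
theorem exists_near_cstarGenerated (hI : IsClosedIdeal I) {n : ℕ} (hB : Dense (genSA B (n + 1)))
    (μ : Fin (n + 1) → ℝ) {x : Fin (n + 1) → B} (hxI : ∀ j, x j ∈ I)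
    (hx : ∀ j, IsSelfAdjoint (x j)) (α : ℂ) {c : B} (hc : c ∈ I) {ε δ : ℝ} (hε : 0 < ε)
    (hδ : 0 < δ) :
    ∃ (μ' : Fin (n + 1) → ℝ) (x' : Fin (n + 1) → B), (∀ j, |μ' j - μ j| < ε) ∧ (∀ j, x' j ∈ I) ∧
      (∀ j, IsSelfAdjoint (x' j)) ∧ (∀ j, ‖x' j - x j‖ < ε) ∧
      ∃ w ∈ cstarGenerated (fun j => algebraMap ℝ B (μ' j) + x' j),
        ‖w - (algebraMap ℂ B α + c)‖ < δ := by
  obtain ⟨μ', hμ', hμ0⟩ : ∃ μ' : Fin (n + 1) → ℝ, (∀ j, |μ' j - μ j| < ε) ∧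
      0 < ∑ j, μ' j * μ' j := by
    have key : ∀ ν : Fin (n + 1) → ℝ, ν 0 ≠ 0 → 0 < ∑ j, ν j * ν j := fun ν h0 =>
      (mul_self_pos.2 h0).trans_le (Finset.single_le_sum (f := fun j => ν j * ν j)
        (fun j _ => mul_self_nonneg _) (Finset.mem_univ 0))
    by_cases h0 : μ 0 = 0
    · refine ⟨Function.update μ 0 (ε / 2), fun j => ?_, key _ (by simp [hε.ne'])⟩
      rcases eq_or_ne j 0 with rfl | hj
      · rw [Function.update_self, h0, sub_zero, abs_of_pos (by positivity)]
        linarith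
      · rw [Function.update_of_ne hj, sub_self, abs_zero]
        exact hε
    · exact ⟨μ, fun j => by simpa using hε, key _ h0⟩
  obtain ⟨x1, hx1I, hx1, hx1n, hx1u⟩ :=
    exists_isUnit_sum_sq_near hI hB hμ0 hxI hx (show 0 < ε / 2 by positivity)
  obtain ⟨ρ, hρ, hball⟩ : ∃ ρ > 0, ∀ x' : Fin (n + 1) → B, (∀ j, ‖x' j - x1 j‖ < ρ) →
      IsUnit (∑ j, (algebraMap ℝ B (μ' j) + x' j) * (algebraMap ℝ B (μ' j) + x' j)) := by
    have hopen : IsOpen {x' : Fin (n + 1) → B |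
        IsUnit (∑ j, (algebraMap ℝ B (μ' j) + x' j) * (algebraMap ℝ B (μ' j) + x' j))} :=
      Units.isOpen.preimage (f := fun x' : Fin (n + 1) → B =>
        ∑ j, (algebraMap ℝ B (μ' j) + x' j) * (algebraMap ℝ B (μ' j) + x' j)) (by fun_prop)
    obtain ⟨ρ, hρ, h⟩ := Metric.isOpen_iff.1 hopen x1 hx1u
    refine ⟨ρ, hρ, fun x' hx' => h ?_⟩
    rw [Metric.mem_ball, dist_pi_lt_iff hρ]
    simpa only [dist_eq_norm] using hx'
  have hσ : 0 < min (ε / 2) ρ / 2 := by positivity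
  obtain ⟨x2, hx2I, hx2, hx2n, k, hk⟩ :=
    exists_sum_sq_mul_near hI hB hx1I hx1 hc hσ (show 0 < δ / 4 by positivity)
  obtain ⟨x3, hx3I, hx3, hx3n, hS⟩ :=
    exists_near_adjoin_one hI hB μ' hx2I hx2 hσ (by positivity) hk
  have h31 : ∀ j, ‖x3 j - x1 j‖ < min (ε / 2) ρ := fun j => by
    have := norm_sub_le_norm_sub_add_norm_sub (x3 j) (x2 j) (x1 j)
    linarith [hx3n j, hx2n j]
  refine ⟨μ', x3, hμ', hx3I, hx3, fun j => ?_, ?_⟩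
  · have := norm_sub_le_norm_sub_add_norm_sub (x3 j) (x1 j) (x j)
    linarith [h31 j, hx1n j, min_le_left (ε / 2) ρ]
  set b : Fin (n + 1) → B := fun j => algebraMap ℝ B (μ' j) + x3 j with hb
  have hcl : IsClosed (cstarGenerated b : Set B) :=
    NonUnitalStarSubalgebra.isClosed_topologicalClosure _
  have hbm : ∀ j, b j ∈ cstarGenerated b := fun j =>
    NonUnitalStarSubalgebra.le_topologicalClosure _ (NonUnitalStarAlgebra.subset_adjoin ℂ _ ⟨j, rfl⟩)
  have h1 : 1 ∈ cstarGenerated b := one_mem_of_isUnit hcl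
    (sum_mem fun j _ => mul_mem (hbm j) (hbm j))
    (isSelfAdjoint_sum_mul_self fun j => (isSelfAdjoint_algebraMap_real _).add (hx3 j))
    (hball x3 fun j => (h31 j).trans_le (min_le_right _ _))
  obtain ⟨w, hw, hwc⟩ := hS _ hcl h1 fun j => by
    have e : x3 j = b j - ((μ' j : ℝ) : ℂ) • (1 : B) := by
      rw [hb, Complex.coe_smul, ← Algebra.algebraMap_eq_smul_one]
      simp
    rw [e]
    exact sub_mem (hbm j) (SMulMemClass.smul_mem _ h1)
  refine ⟨algebraMap ℂ B α + w, add_mem ?_ hw, ?_⟩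
  · rw [Algebra.algebraMap_eq_smul_one]
    exact SMulMemClass.smul_mem _ h1
  · rw [add_sub_add_left_eq_sub]
    linarith

end

section

theorem isClosed_selfAdjoint_set (D : Type*) [NonUnitalCStarAlgebra D] :
    IsClosed (selfAdjoint D : Set D) :=
  isClosed_eq continuous_star continuous_id

theorem exists_continuous_mem_cstarGenerated {D : Type*} [NonUnitalCStarAlgebra D] {n : ℕ}
    (a : Fin n → selfAdjoint D) {w : D}
    (hw : w ∈ NonUnitalStarAlgebra.adjoin ℂ (Set.range fun i => (a i : D))) :
    ∃ W : (Fin n → selfAdjoint D) → D, (∀ a', W a' ∈ cstarGenerated fun i => (a' i : D)) ∧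
      Continuous W ∧ W a = w := by
  let p : D → Prop := fun w => ∃ W : (Fin n → selfAdjoint D) → D,
    (∀ a', W a' ∈ cstarGenerated fun i => (a' i : D)) ∧ Continuous W ∧ W a = w
  have ha : ∀ i, IsSelfAdjoint (a i : D) := fun i => (a i).2
  refine mem_adjoin_range_induction (p := p) ha ?_ ?_ ?_ ?_ ?_ hw
  · refine fun i => ⟨fun a' => a' i, fun a' => ?_, ?_, rfl⟩
    · exact NonUnitalStarSubalgebra.le_topologicalClosure _
        (NonUnitalStarAlgebra.subset_adjoin ℂ _ ⟨i, rfl⟩)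
    · exact continuous_subtype_val.comp (continuous_apply i)
  · exact ⟨fun _ => 0, fun _ => zero_mem _, continuous_const, rfl⟩
  · rintro x y ⟨V, hV, hVc, rfl⟩ ⟨W, hW, hWc, rfl⟩
    exact ⟨fun a => V a + W a, fun a => add_mem (hV a) (hW a), hVc.add hWc, rfl⟩
  · rintro x y ⟨V, hV, hVc, rfl⟩ ⟨W, hW, hWc, rfl⟩
    exact ⟨fun a => V a * W a, fun a => mul_mem (hV a) (hW a), hVc.mul hWc, rfl⟩
  · rintro c x ⟨V, hV, hVc, rfl⟩
    exact ⟨fun a => c • V a, fun a => SMulMemClass.smul_mem _ (hV a), hVc.const_smul c, rfl⟩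

theorem isOpen_setOf_exists_cstarGenerated {D : Type*} [NonUnitalCStarAlgebra D] {n : ℕ} (c : D)
    (δ : ℝ) : IsOpen {a : Fin n → selfAdjoint D |
      ∃ w ∈ cstarGenerated (fun i => (a i : D)), ‖w - c‖ < δ} := by
  rw [isOpen_iff_mem_nhds]
  rintro a ⟨w, hw, hwc⟩
  obtain ⟨w', hw', hd⟩ := Metric.mem_closure_iff.1 hw (δ - ‖w - c‖) (by linarith)
  obtain ⟨W, hW, hWc, rfl⟩ := exists_continuous_mem_cstarGenerated a hw'
  have hlt : ‖W a - c‖ < δ := by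
    rw [dist_comm, dist_eq_norm] at hd
    linarith [norm_sub_le_norm_sub_add_norm_sub (W a) w c]
  filter_upwards [((hWc.sub continuous_const).norm.continuousAt (x := a)).eventually
    (gt_mem_nhds hlt)] with a' ha'
  exact ⟨W a', hW a', ha'⟩

/-- Baire category: generating tuples are dense as soon as each element is approximately generated
by a dense set of tuples. -/
theorem dense_genSA_of_forall_dense {D : Type*} [NonUnitalCStarAlgebra D]
    [TopologicalSpace.SeparableSpace D] {n : ℕ}
    (h : ∀ (c : D) (δ : ℝ), 0 < δ → Dense {a : Fin n → selfAdjoint D |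
      ∃ w ∈ cstarGenerated (fun i => (a i : D)), ‖w - c‖ < δ}) : Dense (genSA D n) := by
  have : CompleteSpace (selfAdjoint D) := (isClosed_selfAdjoint_set D).completeSpace_coe
  have hb : BaireSpace (Fin n → selfAdjoint D) := BaireSpace.of_completelyPseudoMetrizable
  have hd : Dense (⋂ p : ℕ × ℕ, {a : Fin n → selfAdjoint D |
      ∃ w ∈ cstarGenerated (fun i => (a i : D)),
        ‖w - TopologicalSpace.denseSeq D p.1‖ < 1 / ((p.2 : ℝ) + 1)}) :=
    dense_iInter_of_isOpen (fun p => isOpen_setOf_exists_cstarGenerated _ _)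
      fun p => h _ _ Nat.one_div_pos_of_nat
  refine hd.mono fun a ha => ?_
  rw [Set.mem_iInter] at ha
  have hcl : IsClosed (cstarGenerated (fun i => (a i : D)) : Set D) :=
    NonUnitalStarSubalgebra.isClosed_topologicalClosure _
  refine eq_top_iff.2 fun c _ => ?_
  change c ∈ (cstarGenerated (fun i => (a i : D)) : Set D)
  rw [← hcl.closure_eq, Metric.mem_closure_iff]
  intro ε hε
  obtain ⟨m, hm⟩ := (TopologicalSpace.denseRange_denseSeq D).exists_dist_lt c (half_pos hε)
  obtain ⟨k, hk⟩ := exists_nat_one_div_lt (half_pos hε)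
  obtain ⟨w, hw, hwc⟩ := ha (m, k)
  refine ⟨w, hw, ?_⟩
  rw [← dist_eq_norm, dist_comm] at hwc
  have := dist_triangle c (TopologicalSpace.denseSeq D m) w
  simp only at hwc
  linarith

theorem separableSpace_of_generates {B : Type*} [CStarAlgebra B] {n : ℕ} {b : Fin n → B}
    (hb : ∀ i, IsSelfAdjoint (b i)) (hgen : cstarGenerated b = ⊤) :
    TopologicalSpace.SeparableSpace B := by
  let s : Set B := Set.range fun L : List (Fin n) => (L.map b).prod
  have hs : TopologicalSpace.IsSeparable (Submodule.span ℂ s : Set B) :=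
    (Set.countable_range _).isSeparable.span
  have hsub : (NonUnitalStarAlgebra.adjoin ℂ (Set.range b) : Set B) ⊆ Submodule.span ℂ s := by
    intro w hw
    refine mem_adjoin_range_induction hb (p := fun w => w ∈ Submodule.span ℂ s)
      (fun i => Submodule.subset_span ⟨[i], by simp⟩) (zero_mem _) (fun _ _ => add_mem)
      (fun x y hx hy => ?_) (fun c x => Submodule.smul_mem _ c) hw
    have hxy := Submodule.mul_mem_mul hx hy
    rw [Submodule.span_mul_span] at hxy
    refine Submodule.span_mono ?_ hxy
    rintro _ ⟨_, ⟨L, rfl⟩, _, ⟨L', rfl⟩, rfl⟩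
    exact ⟨L ++ L', by simp⟩
  have hcl := (hs.mono hsub).closure
  have htop : closure (NonUnitalStarAlgebra.adjoin ℂ (Set.range b) : Set B) = Set.univ :=
    congrArg (fun S : NonUnitalStarSubalgebra ℂ B => (S : Set B)) hgen
  rw [htop] at hcl
  exact TopologicalSpace.isSeparable_univ_iff.1 hcl

variable {J B : Type*} [NonUnitalCStarAlgebra J] [CStarAlgebra B] {φ : J →⋆ₙₐ[ℂ] B}

theorem isClosedIdeal_range (hφ : Function.Injective φ) (hl : ∀ (b : B) (j : J), ∃ j', φ j' = b * φ j)
    (hr : ∀ (b : B) (j : J), ∃ j', φ j' = φ j * b) :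
    IsClosedIdeal (NonUnitalStarAlgHom.range φ) where
  isClosed := by
    have := (NonUnitalStarAlgHom.isometry φ hφ).isClosedEmbedding.isClosed_range
    simpa using this
  mul_mem_left := by
    rintro b _ ⟨j, rfl⟩
    obtain ⟨j', hj'⟩ := hl b j
    exact ⟨j', hj'⟩
  mul_mem_right := by
    rintro b _ ⟨j, rfl⟩
    obtain ⟨j', hj'⟩ := hr b j
    exact ⟨j', hj'⟩

theorem starLift_eq_algebraMap_add (x : Unitization ℂ J) :
    Unitization.starLift φ x = algebraMap ℂ B x.fst + φ x.snd :=
  rfl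

theorem starLift_injective (hφ : Function.Injective φ) (hJ : ¬ HasUnit J) :
    Function.Injective (Unitization.starLift φ) := by
  rw [injective_iff_map_eq_zero]
  intro x hx
  rw [starLift_eq_algebraMap_add] at hx
  have h0 : x.fst = 0 := by
    by_contra h
    refine hJ ⟨-(x.fst⁻¹ • x.snd), fun a => ?_⟩
    have key : φ (x.fst⁻¹ • x.snd) = -1 := by
      rw [map_smul, eq_neg_of_add_eq_zero_right hx, Algebra.algebraMap_eq_smul_one, smul_neg,
        smul_smul, inv_mul_cancel₀ h, one_smul]
    constructor <;> apply hφ <;> rw [map_mul, map_neg, key] <;> simp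
  rw [h0, map_zero, zero_add] at hx
  exact Unitization.ext h0 (hφ (hx.trans (map_zero φ).symm))

theorem dense_genSA_unitization (hφ : Function.Injective φ)
    (hl : ∀ (b : B) (j : J), ∃ j', φ j' = b * φ j)
    (hr : ∀ (b : B) (j : J), ∃ j', φ j' = φ j * b) (hJ : ¬ HasUnit J) {n : ℕ}
    (hB : Dense (genSA B (n + 1))) : Dense (genSA (Unitization ℂ J) (n + 1)) := by
  have hI := isClosedIdeal_range hφ hl hr
  set ψ : Unitization ℂ J →⋆ₐ[ℂ] B := Unitization.starLift φ with hψ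
  have hψi : Isometry ψ := NonUnitalStarAlgHom.isometry ψ (starLift_injective hφ hJ)
  have hψn : ∀ x, ‖ψ x‖ = ‖x‖ := NonUnitalStarAlgHom.norm_map ψ (starLift_injective hφ hJ)
  have hψa : ∀ x, ψ x = algebraMap ℂ B x.fst + φ x.snd := starLift_eq_algebraMap_add
  have : TopologicalSpace.SeparableSpace B := by
    obtain ⟨b, hb⟩ := hB.nonempty
    exact separableSpace_of_generates (fun i => (b i).2) hb
  have : TopologicalSpace.SeparableSpace (Unitization ℂ J) := by
    have := UniformSpace.secondCountable_of_separable B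
    have := hψi.isEmbedding.secondCountableTopology
    infer_instance
  refine dense_genSA_of_forall_dense fun c δ hδ => ?_
  rw [Metric.dense_iff]
  intro a ε hε
  have hre : ∀ i, (((a i : Unitization ℂ J).fst.re : ℝ) : ℂ) = (a i : Unitization ℂ J).fst := by
    intro i
    rw [← Complex.conj_eq_iff_re]
    exact congrArg (fun x : Unitization ℂ J => x.fst) (a i).2
  obtain ⟨μ, x, hμ, hxI, hx, hxn, w, hw, hwc⟩ := exists_near_cstarGenerated hI hB
    (fun i => (a i : Unitization ℂ J).fst.re) (x := fun i => φ (a i : Unitization ℂ J).snd)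
    (fun i => ⟨_, rfl⟩)
    (fun i => (show IsSelfAdjoint (a i : Unitization ℂ J).snd from
      congrArg (fun x : Unitization ℂ J => x.snd) (a i).2).map φ) c.fst (c := φ c.snd) ⟨_, rfl⟩
    (show 0 < ε / 2 by positivity) hδ
  choose x0 hx0 using hxI
  have hx0s : ∀ i, IsSelfAdjoint (x0 i) := fun i => hφ (by
    rw [map_star]
    erw [hx0 i]
    exact hx i)
  let d : Fin (n + 1) → selfAdjoint (Unitization ℂ J) := fun i =>
    ⟨Unitization.inl (μ i : ℂ) + (x0 i : Unitization ℂ J), by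
      rw [selfAdjoint.mem_iff, star_add, ← Unitization.inl_star, ← Unitization.inr_star,
        (hx0s i).star_eq]
      simp⟩
  have hx0' : ∀ i, φ (x0 i) = x i := hx0
  have hd : ∀ i, ψ (d i) = algebraMap ℝ B (μ i) + x i := by
    intro i
    rw [hψa, ← hx0' i]
    simp only [d, Unitization.fst_add, Unitization.fst_inl, Unitization.fst_inr, add_zero,
      Unitization.snd_add, Unitization.snd_inl, Unitization.snd_inr, zero_add]
    rfl
  refine ⟨d, ?_, ?_⟩
  · rw [Metric.mem_ball, dist_pi_lt_iff hε]
    intro i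
    rw [Subtype.dist_eq, ← hψi.dist_eq, hd, hψa, dist_eq_norm]
    have e : algebraMap ℝ B (μ i) + x i - (algebraMap ℂ B (a i : Unitization ℂ J).fst +
        φ (a i : Unitization ℂ J).snd) =
        algebraMap ℝ B (μ i - (a i : Unitization ℂ J).fst.re) +
          (x i - φ (a i : Unitization ℂ J).snd) := by
      have e1 : algebraMap ℂ B (a i : Unitization ℂ J).fst =
          algebraMap ℝ B (a i : Unitization ℂ J).fst.re := by
        nth_rw 1 [← hre i]
        rfl
      rw [e1, map_sub]
      abel
    rw [e]
    refine (norm_add_le _ _).trans_lt ?_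
    have h1 : ‖algebraMap ℝ B (μ i - (a i : Unitization ℂ J).fst.re)‖ ≤
        |μ i - (a i : Unitization ℂ J).fst.re| := by
      rw [Algebra.algebraMap_eq_smul_one, norm_smul, Real.norm_eq_abs]
      have : ‖(1 : B)‖ ≤ 1 := by
        rcases subsingleton_or_nontrivial B with h | h
        · simp [Subsingleton.elim (1 : B) 0]
        · simp
      nlinarith [abs_nonneg (μ i - (a i : Unitization ℂ J).fst.re)]
    linarith [hμ i, hxn i]
  · have hrange : (cstarGenerated fun i => algebraMap ℝ B (μ i) + x i) ≤
        (cstarGenerated fun i => (d i : Unitization ℂ J)).map ψ := by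
      refine NonUnitalStarSubalgebra.topologicalClosure_minimal _ ?_ ?_
      · rw [NonUnitalStarAlgebra.adjoin_le_iff]
        rintro _ ⟨i, rfl⟩
        exact ⟨d i, NonUnitalStarSubalgebra.le_topologicalClosure _
          (NonUnitalStarAlgebra.subset_adjoin ℂ _ ⟨i, rfl⟩), hd i⟩
      · rw [NonUnitalStarSubalgebra.coe_map]
        exact hψi.isClosedEmbedding.isClosedMap _
          (NonUnitalStarSubalgebra.isClosed_topologicalClosure _)
    obtain ⟨w', hw', rfl⟩ := hrange hw
    refine ⟨w', hw', ?_⟩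
    rw [← hψn, map_sub, hψa c]
    exact hwc

theorem dense_genSA_of_hasUnit (hφ : Function.Injective φ)
    (hl : ∀ (b : B) (j : J), ∃ j', φ j' = b * φ j)
    (hr : ∀ (b : B) (j : J), ∃ j', φ j' = φ j * b) (hJ : HasUnit J) {n : ℕ}
    (hB : Dense (genSA B n)) : Dense (genSA J n) := by
  obtain ⟨e, he⟩ := hJ
  have hes : star e = e := by
    have h1 := (he (star e)).1
    have h2 := congrArg star h1
    rw [star_mul, star_star, h1] at h2
    exact h2
  have hφn : ∀ x, ‖φ x‖ = ‖x‖ := NonUnitalStarAlgHom.norm_map φ hφ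
  set p := φ e with hp
  have hps : star p = p := by rw [hp, ← map_star, hes]
  have hpj : ∀ j, p * φ j = φ j := fun j => by rw [hp, ← map_mul, (he j).1]
  have hjp : ∀ j, φ j * p = φ j := fun j => by rw [hp, ← map_mul, (he j).2]
  have hpp : p * p = p := hpj e
  have hcomm : ∀ b, p * b = b * p := by
    intro b
    obtain ⟨j, hj⟩ := hl b e
    obtain ⟨j', hj'⟩ := hr b e
    have h1 := hpj j
    have h2 := hjp j'
    rw [hj] at h1
    rw [hj'] at h2
    rw [← h2, mul_assoc, h1]
  have hpn : ‖p‖ ≤ 1 := by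
    have h1 : ‖p‖ * ‖p‖ = ‖p‖ := by rw [← CStarRing.norm_star_mul_self, hps, hpp]
    nlinarith [norm_nonneg p, sq_nonneg (‖p‖ - 1)]
  have hmulp : ∀ b, ‖b * p‖ ≤ ‖b‖ := fun b => by
    refine (norm_mul_le _ _).trans ?_
    nlinarith [norm_nonneg b]
  rw [Metric.dense_iff]
  intro a ε hε
  obtain ⟨b, hb, hba, hgen⟩ := exists_generates_of_dense hB
    (a := fun i => φ (a i)) (fun i => (a i).2.map φ) hε
  choose c hc using fun i => hl (b i) e
  have hcs : ∀ i, IsSelfAdjoint (c i) := fun i => hφ (by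
    rw [map_star, hc i, star_mul, hps, (hb i).star_eq, hcomm])
  refine ⟨fun i => ⟨c i, hcs i⟩, ?_, ?_⟩
  · rw [Metric.mem_ball, dist_pi_lt_iff hε]
    intro i
    rw [Subtype.dist_eq, dist_eq_norm, ← hφn, map_sub, hc i]
    change ‖b i * p - φ (a i)‖ < ε
    rw [← hjp (a i), ← sub_mul]
    exact (hmulp _).trans_lt (hba i)
  · have hadj : ∀ w ∈ NonUnitalStarAlgebra.adjoin ℂ (Set.range b),
        ∃ v ∈ NonUnitalStarAlgebra.adjoin ℂ (Set.range c), φ v = w * p := by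
      intro w hw
      refine mem_adjoin_range_induction hb (p := fun w =>
        ∃ v ∈ NonUnitalStarAlgebra.adjoin ℂ (Set.range c), φ v = w * p) ?_ ?_ ?_ ?_ ?_ hw
      · exact fun i => ⟨c i, NonUnitalStarAlgebra.subset_adjoin ℂ _ ⟨i, rfl⟩, hc i⟩
      · exact ⟨0, zero_mem _, by simp⟩
      · rintro x y ⟨v, hv, hvx⟩ ⟨v', hv', hvy⟩
        exact ⟨v + v', add_mem hv hv', by rw [map_add, hvx, hvy, add_mul]⟩
      · rintro x y ⟨v, hv, hvx⟩ ⟨v', hv', hvy⟩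
        refine ⟨v * v', mul_mem hv hv', ?_⟩
        rw [map_mul, hvx, hvy, mul_assoc, ← mul_assoc p y p, hcomm y, mul_assoc y p p, hpp,
          mul_assoc]
      · rintro r x ⟨v, hv, hvx⟩
        exact ⟨r • v, SMulMemClass.smul_mem _ hv, by rw [map_smul, hvx, smul_mul_assoc]⟩
    refine eq_top_iff.2 fun z _ => ?_
    refine Metric.mem_closure_iff.2 fun δ hδ => ?_
    have hz : φ z ∈ cstarGenerated b := hgen ▸ trivial
    obtain ⟨w, hw, hwz⟩ := Metric.mem_closure_iff.1 hz δ hδ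
    obtain ⟨v, hv, hvw⟩ := hadj w hw
    refine ⟨v, hv, ?_⟩
    rw [dist_eq_norm, ← hφn, map_sub, hvw, ← hjp z, ← sub_mul]
    rw [dist_eq_norm] at hwz
    exact (hmulp _).trans_lt hwz

theorem generatorRankSA_le_generatorRankSA {C D : Type*} [NonUnitalCStarAlgebra C]
    [NonUnitalCStarAlgebra D]
    (h : ∀ n, Dense (genSA D (n + 1)) → Dense (genSA C (n + 1))) :
    generatorRankSA C ≤ generatorRankSA D :=
  sInf_le_sInf fun _ ⟨n, hn, hd⟩ => ⟨n, hn, h n hd⟩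

theorem generatorRank_le_generatorRankSA (hφ : Function.Injective φ)
    (hl : ∀ (b : B) (j : J), ∃ j', φ j' = b * φ j)
    (hr : ∀ (b : B) (j : J), ∃ j', φ j' = φ j * b) : generatorRank J ≤ generatorRankSA B := by
  rw [generatorRank]
  split_ifs with hJ
  · exact generatorRankSA_le_generatorRankSA fun n => dense_genSA_of_hasUnit hφ hl hr hJ
  · exact generatorRankSA_le_generatorRankSA fun n => dense_genSA_unitization hφ hl hr hJ

/-- A C⋆-algebra with a two-sided identity is a unital C⋆-algebra. -/
abbrev NonUnitalCStarAlgebra.toCStarAlgebra {A : Type*} [h : NonUnitalCStarAlgebra A] (e : A)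
    (he : ∀ a : A, e * a = a ∧ a * e = a) : CStarAlgebra A :=
  let R : NormedRing A := { h with
    one := e
    one_mul := fun a => (he a).1
    mul_one := fun a => (he a).2 }
  let alg : Algebra ℂ A := @Algebra.ofModule ℂ A _ R.toSemiring h.toModule
    (fun c x y => smul_mul_assoc c x y) (fun c x y => mul_smul_comm c x y)
  { h, R, alg with norm_smul_le := h.norm_smul_le }

end

theorem mainTheorem6 {A : Type*} [NonUnitalCStarAlgebra A]
    (J : TwoSidedIdeal A) (hJ : IsClosed (J : Set A)) :
    generatorRank (J.toCStarSubalgebra hJ) ≤ generatorRank A := by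
  by_cases hA : HasUnit A
  · rw [generatorRank.eq_def A, if_pos hA]
    obtain ⟨e, he⟩ := hA
    let _ : CStarAlgebra A := NonUnitalCStarAlgebra.toCStarAlgebra e he
    exact generatorRank_le_generatorRankSA (B := A)
      (φ := NonUnitalStarSubalgebraClass.subtype (J.toCStarSubalgebra hJ))
      Subtype.val_injective
      (fun b j => ⟨⟨b * j, J.mul_mem_left _ _ j.2⟩, rfl⟩)
      (fun b j => ⟨⟨j * b, J.mul_mem_right _ _ j.2⟩, rfl⟩)
  · rw [generatorRank.eq_def A, if_neg hA]
    refine generatorRank_le_generatorRankSA (B := Unitization ℂ A)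
      (φ := (Unitization.inrNonUnitalStarAlgHom ℂ A).comp
        (NonUnitalStarSubalgebraClass.subtype (J.toCStarSubalgebra hJ)))
      (Unitization.inr_injective.comp Subtype.val_injective)
      (fun b j => ⟨⟨b.fst • (j : A) + b.snd * j, ?_⟩, ?_⟩)
      (fun b j => ⟨⟨b.fst • (j : A) + j * b.snd, ?_⟩, ?_⟩)
    · exact J.add_mem (J.smul_mem_of_isClosed hJ _ j.2) (J.mul_mem_left _ _ j.2)
    · change ((b.fst • (j : A) + b.snd * j : A) : Unitization ℂ A) = b * ((j : A) : Unitization ℂ A)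
      ext <;> simp
    · exact J.add_mem (J.smul_mem_of_isClosed hJ _ j.2) (J.mul_mem_right _ _ j.2)
    · change ((b.fst • (j : A) + j * b.snd : A) : Unitization ℂ A) = ((j : A) : Unitization ℂ A) * b
      ext <;> simp
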